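/- Let $\Sigma$ be a (finite) fan of rational polyhedral cones in $\mathbb R^n$, none of which contains a line. For $\rho\in\Sigma$ let $T(\rho)$ be its linear span, let $T_{\mathbb Z_2}(\rho)\subset\mathbb Z_2^n$ be the reduction modulo $2$ of $T(\rho)\cap\mathbb Z^n$, and put $\mathbb R(\rho)=\mathbb R^n/T(\rho)$ and $\mathbb Z_2(\rho)=\mathbb Z_2^n/T_{\mathbb Z_2}(\rho)$; for $\rho\subset\eta$ let $\pi:\mathbb Z_2(\rho)\to\mathbb Z_2(\eta)$ be the projection. The tropical toric variety $\mathbb T\Sigma=\bigsqcup_{\rho\in\Sigma}\mathbb R(\rho)$ is the direct limit of the charts $\mathbb TU_\eta=\operatorname{Hom}(\eta^\vee\cap(\mathbb Z^n)^\vee,\mathbb T)=\bigsqcup_{\kappa\text{ face of }\eta}\mathbb R(\kappa)$, where $\mathbb T=\mathbb R\cup\{-\infty\}$ and each chart has the coarsest topology for which all evaluations are continuous; a point moving to infinity in a direction of the relative interior of $\rho$ tends to the orbit $\mathbb R(\rho)$. The real tropical toric variety $\mathfrak R\mathbb T\Sigma$ is the quotient of $\bigsqcup_{\varepsilon\in\mathbb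 Z_2^n}\mathbb T\Sigma(\varepsilon)$, a disjoint union of copies of $\mathbb T\Sigma$, that identifies the copies labelled by $\varepsilon$ and $\varepsilon'$ along $\mathbb R(\rho)$ if and only if $\varepsilon+\varepsilon'\in T_{\mathbb Z_2}(\rho)$. A (rational) polyhedron $\sigma$ of sedentarity $\rho$ in $\mathbb T\Sigma$ is the closure of a nonempty polyhedron in $\mathbb R(\rho)$ given by finitely many affine inequalities with integral linear parts. Its dimension and its tangent space $T(\sigma)\subset\mathbb R(\rho)$ are those of $\sigma\cap\mathbb R(\rho)$, and $T_{\mathbb Z_2}(\sigma)\subset\mathbb Z_2(\rho)$ is the reduction modulo $2$ of the lattice of integral points of $T(\sigma)$. A face of $\sigma$ is the closure of a nonempty face of $\sigma\cap\mathbb R(\eta)$, for some $\eta\in\Sigma$. A polyhedral complex $\mathcal X$ in $\mathbb T\Sigma$ is a locally finite collection of such polyhedra that contains the faces of its members and in which any two members with nonempty intersection meet in a common face. Its facets are its maximal members. Let $\mathcal X$ be a polyhedral complex in $\mathbb T\Sigma$ of pure dimension $d$ (all facets have dimension $d$) and of pure sedentarity $\rho$ (the support $|\mathcal X|$ is the closure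 of $|\mathcal X|\cap\mathbb R(\rho)$). Let $\mathcal E$ be a real phase structure on $\mathcal X$, that is, a map assigning to each facet $\sigma$ a $d$-dimensional affine subspace $\mathcal E(\sigma)$ of $\mathbb Z_2(\rho)$ such that 1. $\mathcal E(\sigma)$ is parallel to $T_{\mathbb Z_2}(\sigma)$ for every facet $\sigma$; 2. for every face $\tau$ of dimension $d-1$ and sedentarity $\rho$, every element of $\mathbb Z_2(\rho)$ lies in $\mathcal E(\sigma)$ for an even number of the facets $\sigma\supset\tau$. For a face $\tau$ of sedentarity $\eta$ let $\mathcal E(\tau)=\bigcup_{\sigma\supset\tau}\pi(\mathcal E(\sigma))\subset\mathbb Z_2(\eta)$, the union over the facets $\sigma$ containing $\tau$. For $\varepsilon\in\mathbb Z_2(\eta)$ let $\tau(\varepsilon)\subset\mathfrak R\mathbb T\Sigma$ be the copy of $\tau$ labelled by $\varepsilon$; its faces are the copies contained in it of the faces of $\tau$. The patchwork is $$\mathfrak R(\mathcal X,\mathcal E)=\{\sigma(\varepsilon):\sigma\in\mathcal X,\ \varepsilon\in\mathcal E(\sigma)\}.$$ **Proposition.** The patchwork $\mathfrak R(\mathcal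 X,\mathcal E)$ is a locally finite collection of polyhedra in $\mathfrak R\mathbb T\Sigma$ that is closed under taking faces, and it represents a closed cellular Borel–Moore chain over $\mathbb Z_2$ in $\mathfrak R\mathbb T\Sigma$: the sum of its $d$-dimensional polyhedra has zero cellular boundary. Equivalently, every $(d-1)$-dimensional polyhedron of $\mathfrak R(\mathcal X,\mathcal E)$ is contained in an even (finite) number of facets (maximal members) of $\mathfrak R(\mathcal X,\mathcal E)$. -/

import Mathlib

open Set Topology

noncomputable section

namespace TropPatch

/-! ### Lattices and rational fans -/

/-- The linear form on `ℝⁿ` given by an element `m` of the dual lattice `(ℤⁿ)^∨`. -/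
def latticeForm {n : ℕ} (m : Fin n → ℤ) : (Fin n → ℝ) →ₗ[ℝ] ℝ :=
  ∑ i, (m i : ℝ) • LinearMap.proj i

/-- The inclusion `ℤⁿ → ℝⁿ`. -/
def intVec {n : ℕ} (z : Fin n → ℤ) : Fin n → ℝ := fun i => (z i : ℝ)

/-- Reduction modulo two `ℤⁿ → ℤ₂ⁿ`. -/
def modTwo {n : ℕ} (z : Fin n → ℤ) : Fin n → ZMod 2 := fun i => (z i : ZMod 2)

/-- For a real subspace `W ⊆ ℝⁿ`, the image in `ℤ₂ⁿ` of the lattice `W ∩ ℤⁿ`. Since `W ∩ ℤⁿ` is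
saturated, this is `(W ∩ ℤⁿ) ⊗ ℤ₂ ⊆ ℤ₂ⁿ`. -/
def binaryPart {n : ℕ} (W : Submodule ℝ (Fin n → ℝ)) :
    Submodule (ZMod 2) (Fin n → ZMod 2) where
  carrier := {v | ∃ z : Fin n → ℤ, intVec z ∈ W ∧ modTwo z = v}
  zero_mem' := ⟨0, by
    have h : intVec (0 : Fin n → ℤ) = 0 := by ext i; simp [intVec]
    rw [h]; exact W.zero_mem, by ext i; simp [modTwo]⟩
  add_mem' := by
    rintro _ _ ⟨y, hy, rfl⟩ ⟨z, hz, rfl⟩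
    refine ⟨y + z, ?_, by ext i; simp [modTwo]⟩
    have h : intVec (y + z) = intVec y + intVec z := by ext i; simp [intVec]
    rw [h]; exact W.add_mem hy hz
  smul_mem' := by
    rintro c _ ⟨z, hz, rfl⟩
    refine ⟨(c.val : ℤ) • z, ?_, ?_⟩
    · have h : intVec ((c.val : ℤ) • z) = (c.val : ℝ) • intVec z := by ext i; simp [intVec]
      rw [h]; exact W.smul_mem _ hz
    · ext i; simp [modTwo]

/-- `T(ρ)`: the linear span of a cone. -/
def coneSpan {n : ℕ} (ρ : PointedCone ℝ (Fin n → ℝ)) : Submodule ℝ (Fin n → ℝ) :=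
  Submodule.span ℝ (ρ : Set (Fin n → ℝ))

/-- A cone generated by finitely many integer vectors. -/
def IsRationalCone {n : ℕ} (ρ : PointedCone ℝ (Fin n → ℝ)) : Prop :=
  ∃ S : Finset (Fin n → ℤ), ρ = PointedCone.hull ℝ (intVec '' (S : Set (Fin n → ℤ)))

/-- `κ` is a face of the rational cone `ρ`: it is cut out of `ρ` by the vanishing of an element
`m ∈ ρ^∨ ∩ (ℤⁿ)^∨`. -/
def IsConeFace {n : ℕ} (κ ρ : PointedCone ℝ (Fin n → ℝ)) : Prop :=
  ∃ m : Fin n → ℤ, (∀ x ∈ ρ, 0 ≤ latticeForm m x) ∧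
    ∀ x, x ∈ κ ↔ x ∈ ρ ∧ latticeForm m x = 0

/-- A fan of rational polyhedral cones in `ℝⁿ`, each of them containing no line. -/
structure RatFan (n : ℕ) where
  cones : Set (PointedCone ℝ (Fin n → ℝ))
  finite : cones.Finite
  rational : ∀ ρ ∈ cones, IsRationalCone ρ
  strictlyConvex : ∀ ρ ∈ cones, ∀ x, x ∈ ρ → -x ∈ ρ → x = 0
  face_mem : ∀ ρ ∈ cones, ∀ κ, IsConeFace κ ρ → κ ∈ cones
  inter_face : ∀ ρ ∈ cones, ∀ η ∈ cones, IsConeFace (ρ ⊓ η) ρ ∧ IsConeFace (ρ ⊓ η) η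

variable {n : ℕ} {F : RatFan n}

/-- `ℝ(ρ) = ℝⁿ / T(ρ)`, the torus orbit of the cone `ρ`. -/
abbrev OrbitSpace (ρ : F.cones) : Type := (Fin n → ℝ) ⧸ coneSpan ρ.1

/-- `ℤ₂(ρ) = ℤ₂ⁿ / T_{ℤ₂}(ρ)`. -/
abbrev SignSpace (ρ : F.cones) : Type := (Fin n → ZMod 2) ⧸ binaryPart (coneSpan ρ.1)

/-- The class in `ℤ₂(ρ)` of an element of `ℤ₂ⁿ`. -/
def signMk (ρ : F.cones) : (Fin n → ZMod 2) →ₗ[ZMod 2] SignSpace ρ :=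
  (binaryPart (coneSpan ρ.1)).mkQ

/-- The canonical projection `π : ℤ₂(ρ) → ℤ₂(η)` for `ρ ⊆ η`. -/
def signProj {ρ η : F.cones} (h : ρ.1 ≤ η.1) : SignSpace ρ →ₗ[ZMod 2] SignSpace η :=
  (binaryPart (coneSpan ρ.1)).mapQ (binaryPart (coneSpan η.1)) LinearMap.id (by
    rintro _ ⟨z, hz, rfl⟩
    exact ⟨z, Submodule.span_mono h hz, rfl⟩)

/-! ### The tropical toric variety

As a set, `𝕋Σ` is the disjoint union of the torus orbits `ℝ(ρ)`, and the affine chart `𝕋U_η` is the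
union of the orbits of the faces of `η`. The point `[x] ∈ ℝ(κ)` is the semigroup homomorphism
`η^∨ ∩ (ℤⁿ)^∨ → 𝕋` sending `m` to `-m(x)` if `m` vanishes on `κ`, and to `-∞` otherwise. With this
sign, a point moving to infinity in a direction of the relative interior of `κ` tends to the orbit
of `κ`, so that `𝕋ⁿ` belongs to the negative orthant. -/

/-- The underlying set of the tropical toric variety: a point is a cone of the fan, its
sedentarity, together with a point in the orbit of the cone. -/
structure TropToric {n : ℕ} (F : RatFan n) where
  sed : F.cones
  coord : OrbitSpace sed

/-- The affine chart `𝕋U_η`. -/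
def Chart (η : F.cones) : Type := {p : TropToric F // IsConeFace p.sed.1 η.1}

open Classical in
/-- Evaluation at the lattice form `m`, with values in `𝕋 = ℝ ∪ {-∞} ⊆ [-∞, ∞]`. -/
def evalForm (m : Fin n → ℤ) (p : TropToric F) : EReal :=
  if h : coneSpan p.sed.1 ≤ LinearMap.ker (latticeForm m) then
    ((-((coneSpan p.sed.1).liftQ (latticeForm m) h p.coord) : ℝ) : EReal)
  else ⊥

/-- The chart `𝕋U_η` has the coarsest topology for which all evaluations at elements of
`η^∨ ∩ (ℤⁿ)^∨` are continuous. -/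
instance (η : F.cones) : TopologicalSpace (Chart η) :=
  ⨅ m : {m : Fin n → ℤ // ∀ x ∈ η.1, 0 ≤ latticeForm m x},
    TopologicalSpace.induced (fun p : Chart η => evalForm m.1 p.1) inferInstance

/-- `𝕋Σ` has the direct limit topology: the finest one for which the inclusions of all charts are
continuous. -/
instance : TopologicalSpace (TropToric F) :=
  ⨆ η : F.cones, TopologicalSpace.coinduced (fun p : Chart η => p.1) inferInstance

/-- The torus orbit of `ρ` as a subset of `𝕋Σ`. -/
def orbit (ρ : F.cones) : Set (TropToric F) := {p | p.sed = ρ}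

/-- The intersection of a subset of `𝕋Σ` with the orbit of `ρ`, as a subset of `ℝ(ρ)`. -/
def slice (A : Set (TropToric F)) (ρ : F.cones) : Set (OrbitSpace ρ) :=
  {y | (⟨ρ, y⟩ : TropToric F) ∈ A}

/-! ### Polyhedra and polyhedral complexes in `𝕋Σ` -/

/-- A polyhedron in `ℝ(ρ)` defined by finitely many affine inequalities whose linear parts belong
to the dual lattice `ρ^⊥ ∩ (ℤⁿ)^∨` of `ℤ(ρ)`. -/
def IsRationalPolyhedron (ρ : F.cones) (P : Set (OrbitSpace ρ)) : Prop :=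
  ∃ S : Finset ((Fin n → ℤ) × ℝ),
    (∀ s ∈ S, ∀ x ∈ ρ.1, latticeForm s.1 x = 0) ∧
    ∀ x : Fin n → ℝ, (coneSpan ρ.1).mkQ x ∈ P ↔ ∀ s ∈ S, latticeForm s.1 x ≤ s.2

/-- `A` is a (nonempty) face of the polyhedron `Q`: the set of points where some linear functional
attains its maximum on `Q`. The zero functional gives `Q` itself. -/
def IsPolyhedronFace {V : Type*} [AddCommGroup V] [Module ℝ V] (A Q : Set V) : Prop :=
  A.Nonempty ∧ ∃ l : V →ₗ[ℝ] ℝ, A = {x | x ∈ Q ∧ ∀ y ∈ Q, l y ≤ l x}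

/-- A nonempty rational polyhedron `σ` in `𝕋Σ`, given by the cone `ρ` (its sedentarity) and the
polyhedron in `ℝ(ρ)` of which it is the closure. Both are determined by the closure. -/
structure TropPoly {n : ℕ} (F : RatFan n) where
  sed : F.cones
  part : Set (OrbitSpace sed)
  nonempty : part.Nonempty
  rational : IsRationalPolyhedron sed part

namespace TropPoly

/-- The polyhedron as a subset of `𝕋Σ`. -/
def carrier (σ : TropPoly F) : Set (TropToric F) :=
  closure ((fun y => (⟨σ.sed, y⟩ : TropToric F)) '' σ.part)

/-- The dimension of the tangent space of `σ`. -/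
def dim (σ : TropPoly F) : ℕ := Module.finrank ℝ (vectorSpan ℝ σ.part)

/-- `τ` is a face of `σ`: the closure of a face of the intersection of `σ` with some orbit. -/
def IsFace (τ σ : TropPoly F) : Prop :=
  IsPolyhedronFace τ.part (slice σ.carrier τ.sed)

end TropPoly

/-- `T_{ℤ₂}(P) = (T(P) ∩ ℤ(ρ)) ⊗ ℤ₂ ⊆ ℤ₂(ρ)` for a subset `P` of `ℝ(ρ)`. -/
def binaryTangent (ρ : F.cones) (P : Set (OrbitSpace ρ)) : Submodule (ZMod 2) (SignSpace ρ) :=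
  (binaryPart ((vectorSpan ℝ P).comap (coneSpan ρ.1).mkQ)).map (signMk ρ)

/-- A (locally finite) rational polyhedral complex in `𝕋Σ`. -/
structure PolyComplex {n : ℕ} (F : RatFan n) where
  faces : Set (TropPoly F)
  face_mem : ∀ σ ∈ faces, ∀ τ : TropPoly F, τ.IsFace σ → τ ∈ faces
  inter_face : ∀ σ₁ ∈ faces, ∀ σ₂ ∈ faces, (σ₁.carrier ∩ σ₂.carrier).Nonempty →
    ∃ κ : TropPoly F, κ.IsFace σ₁ ∧ κ.IsFace σ₂ ∧ κ.carrier = σ₁.carrier ∩ σ₂.carrier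
  locallyFinite : LocallyFinite (fun σ : faces => σ.1.carrier)

namespace PolyComplex

/-- The facets: the maximal faces. -/
def facets (X : PolyComplex F) : Set (TropPoly F) :=
  {σ | σ ∈ X.faces ∧ ∀ σ' ∈ X.faces, σ.carrier ⊆ σ'.carrier → σ'.carrier ⊆ σ.carrier}

/-- The support: the union of all faces. -/
def support (X : PolyComplex F) : Set (TropToric F) := ⋃ σ ∈ X.faces, σ.carrier

/-- Pure dimension `d`. -/
def IsPureDim (X : PolyComplex F) (d : ℕ) : Prop := ∀ σ ∈ X.facets, σ.dim = d

/-- Pure sedentarity `ρ`. -/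
def IsPureSed (X : PolyComplex F) (ρ : F.cones) : Prop :=
  X.support = closure (X.support ∩ orbit ρ)

end PolyComplex

/-! ### Real phase structures -/

/-- A finite family of sets is an even covering if every element lies in an even number of its
members. -/
def IsEvenCovering {ι V : Type*} (S : ι → Set V) : Prop :=
  Finite ι ∧ ∀ v, Even (Nat.card {i // v ∈ S i})

/-- A real phase structure on a polyhedral complex of pure dimension `d` and sedentarity `ρ`. The
tangent space of a facet `σ` is that of its intersection with the orbit of `ρ`. The covering
condition concerns the codimension one faces of the same sedentarity `ρ`. -/
structure RealPhaseStructure (X : PolyComplex F) (ρ : F.cones) (d : ℕ) where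
  phase : X.facets → AffineSubspace (ZMod 2) (SignSpace ρ)
  nonempty : ∀ σ, (phase σ : Set (SignSpace ρ)).Nonempty
  finrank_eq : ∀ σ, Module.finrank (ZMod 2) (phase σ).direction = d
  parallel : ∀ σ, (phase σ).direction = binaryTangent ρ (slice σ.1.carrier ρ)
  evenCovering : ∀ τ ∈ X.faces, τ.sed = ρ → τ.dim + 1 = d →
    IsEvenCovering (fun σ : {σ : X.facets // τ.carrier ⊆ σ.1.carrier} =>
      (phase σ.1 : Set (SignSpace ρ)))

/-- `ℰ(τ)` for an arbitrary face `τ`: the union of the images in `ℤ₂(sed τ)` of the sets `ℰ(σ)`,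
over the facets `σ` containing `τ`. -/
def RealPhaseStructure.signs {X : PolyComplex F} {ρ : F.cones} {d : ℕ}
    (E : RealPhaseStructure X ρ d) (τ : TropPoly F) : Set (SignSpace τ.sed) :=
  {ε | ∃ σ : X.facets, τ.carrier ⊆ σ.1.carrier ∧
    ∃ h : ρ.1 ≤ τ.sed.1, ∃ δ ∈ E.phase σ, signProj h δ = ε}

/-! ### The real tropical toric variety and its polyhedra -/

/-- The gluing of the copies `𝕋Σ(ε)`, `ε ∈ ℤ₂ⁿ`: the copies labelled by `ε` and `ε'` are identified
along the orbit of `ρ` if and only if `ε + ε' ∈ T_{ℤ₂}(ρ)`. -/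
def signSetoid {n : ℕ} (F : RatFan n) : Setoid (Σ _ : Fin n → ZMod 2, TropToric F) where
  r a b := a.2 = b.2 ∧ a.1 - b.1 ∈ binaryPart (coneSpan a.2.sed.1)
  iseqv :=
    { refl := fun a => ⟨rfl, by simp⟩
      symm := by
        rintro ⟨v, p⟩ ⟨w, q⟩ ⟨h, hs⟩
        dsimp only at h hs ⊢
        subst h
        exact ⟨rfl, by simpa using Submodule.neg_mem _ hs⟩
      trans := by
        rintro ⟨v, p⟩ ⟨w, q⟩ ⟨u, r⟩ ⟨h, hs⟩ ⟨h', hs'⟩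
        dsimp only at h hs h' hs' ⊢
        subst h
        subst h'
        exact ⟨rfl, by simpa using Submodule.add_mem _ hs hs'⟩ }

/-- `ℜ𝕋Σ`: the quotient of the disjoint union of the copies `𝕋Σ(ε)`, with the quotient topology. -/
def RealTropToric {n : ℕ} (F : RatFan n) : Type := Quotient (signSetoid F)

instance : TopologicalSpace (RealTropToric F) :=
  inferInstanceAs (TopologicalSpace (Quotient (signSetoid F)))

/-- The image in `ℜ𝕋Σ` of the point `p` in the copy `𝕋Σ(v)`. -/
def realMk (v : Fin n → ZMod 2) (p : TropToric F) : RealTropToric F :=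
  Quotient.mk (signSetoid F) ⟨v, p⟩

/-- A polyhedron `σ(ε)` of `ℜ𝕋Σ`, where `σ` is a polyhedron in `𝕋Σ` of sedentarity `ρ` and
`ε ∈ ℤ₂(ρ)`. -/
structure RealCell {n : ℕ} (F : RatFan n) where
  poly : TropPoly F
  sign : SignSpace poly.sed

namespace RealCell

/-- The subset `σ(ε)` of `ℜ𝕋Σ`: the copy of `σ` with label `v`, for the lifts `v ∈ ℤ₂ⁿ` of `ε` (all
of them give the same set). -/
def carrier (a : RealCell F) : Set (RealTropToric F) :=
  {q | ∃ v, signMk a.poly.sed v = a.sign ∧ ∃ p ∈ a.poly.carrier, realMk v p = q}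

/-- The dimension of `σ(ε)`. -/
def dim (a : RealCell F) : ℕ := a.poly.dim

/-- `b = τ(δ)` is a face of `a = σ(ε)`: the copy inside `σ(ε)` of a face `τ` of `σ`. -/
def IsFace (b a : RealCell F) : Prop := b.poly.IsFace a.poly ∧ b.carrier ⊆ a.carrier

end RealCell

/-- The maximal members of a collection of polyhedra in `ℜ𝕋Σ`. -/
def realFacets (Y : Set (RealCell F)) : Set (RealCell F) :=
  {a | a ∈ Y ∧ ∀ a' ∈ Y, a.carrier ⊆ a'.carrier → a'.carrier ⊆ a.carrier}

/-- The patchwork `ℜ(𝒳, ℰ) = {σ(ε) : σ ∈ 𝒳, ε ∈ ℰ(σ)}`. -/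
def patchwork {X : PolyComplex F} {ρ : F.cones} {d : ℕ} (E : RealPhaseStructure X ρ d) :
    Set (RealCell F) :=
  {a | a.poly ∈ X.faces ∧ a.sign ∈ E.signs a.poly}

/-! ### Cellular Borel–Moore chains over `ℤ₂` -/

/-- Cellular Borel–Moore `q`-chains over `ℤ₂` of a locally finite collection of polyhedra in `ℜ𝕋Σ`
that is closed under taking faces: formal, possibly infinite, sums of its `q`-dimensional members. -/
def BMChain (Y : Set (RealCell F)) (q : ℤ) : Type :=
  {a : RealCell F // a ∈ Y ∧ (a.dim : ℤ) = q} → ZMod 2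

/-- The cellular boundary. Over `ℤ₂` the incidence number of a polyhedron with each of its
codimension one faces is one, so that the coefficient of `∂c` at `b` is the sum of the coefficients
of `c` at the polyhedra that have `b` as a face (finitely many, by local finiteness). -/
def BMChain.boundary {Y : Set (RealCell F)} {q : ℤ} (c : BMChain Y q) : BMChain Y (q - 1) :=
  fun b => ∑ᶠ (a : {a : RealCell F // a ∈ Y ∧ (a.dim : ℤ) = q}) (_ : b.1.IsFace a.1), c a

/-- The chain represented by the collection `Y`: the sum of its `q`-dimensional members. -/
def fundamentalChain (Y : Set (RealCell F)) (q : ℤ) : BMChain Y q := fun _ => 1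

end TropPatch

end

open Set Topology

noncomputable section

namespace TropPatch

variable {n : ℕ} {F : RatFan n}

/-! ### Integer vectors and rational subspaces -/

/-! Pure sedentarity forces every facet of `X` to have sedentarity `ρ`
(`PolyComplex.IsPureSed.sed_eq`), so the facets of the patchwork are exactly the copies `σ(δ)` with
`σ` a facet of `X` and `δ ∈ ℰ(σ)` (`mem_realFacets_iff`). The facets around a cell `τ(ε)` of
sedentarity `η` thus correspond to the pairs `(σ, δ)` with `σ ⊇ τ`, `δ ∈ ℰ(σ)` and `π(δ) = ε`, and
`even_ncard_facet_signs` shows that their number is even.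

If `η = ρ`, then `π` is bijective and the count is the even covering condition. If `η ≠ ρ`, each `σ
⊇ τ` contributes an even number by itself: some nonzero `u ∈ T_{ℤ₂}(σ)` is killed by `π`, and `δ ↦ u
+ δ` is a fixed point free involution of the fibre.

The vector `u` comes from `TropPoly.exists_direction`. Let `f` be an integer form that is
nonnegative on `η` and cuts out `ρ`. If `f` vanished on `T(σ) ∩ T(η)`, some integer form would
vanish on `T(σ)` and equal a positive multiple of `f` on `η`. Its evaluation would be constant on
the part of `σ` in the orbit of `ρ`, yet `-∞` on the orbit of `η`, which the closure of that part
reaches. Hence `f` is nonzero at an integer vector of the intersection, and a 2-adic descent makes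
such a vector survive modulo two outside of `T_{ℤ₂}(ρ)`.

For the boundary statement, the `d`-dimensional cells having a given codimension one cell as a face
must be the facets containing it. This rests on the strict drop of dimension in boundary orbits
(`TropPoly.finrank_vectorSpan_slice_lt`). -/

lemma latticeForm_apply (m : Fin n → ℤ) (x : Fin n → ℝ) :
    latticeForm m x = ∑ i, (m i : ℝ) * x i := by
  simp [latticeForm]

lemma latticeForm_intVec (m z : Fin n → ℤ) : latticeForm m (intVec z) = ((m ⬝ᵥ z : ℤ) : ℝ) := by
  simp [latticeForm_apply, intVec, dotProduct]

lemma latticeForm_neg (m : Fin n → ℤ) : latticeForm (-m) = -latticeForm m := by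
  ext x; simp [latticeForm_apply]

lemma latticeForm_add_nsmul (m μ : Fin n → ℤ) (k : ℕ) (x : Fin n → ℝ) :
    latticeForm (m + k • μ) x = latticeForm m x + k * latticeForm μ x := by
  simp [latticeForm_apply, add_mul, Finset.sum_add_distrib, mul_assoc, Finset.mul_sum]

/-- A real vector is a real combination of integer vectors, each of which satisfies all the linear
equations with integer coefficients satisfied by the vector. -/
lemma exists_int_decomposition (v : Fin n → ℝ) :
    ∃ (k : ℕ) (r : Fin k → ℝ) (q : Fin k → Fin n → ℤ), v = ∑ j, r j • intVec (q j) ∧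
      ∀ m : Fin n → ℤ, latticeForm m v = 0 → ∀ j, m ⬝ᵥ q j = 0 := by
  -- The coordinates of `v` generate a finitely generated torsion-free, hence free, subgroup of `ℝ`.
  -- The `r j` form a basis of it, and `q j` collects the `j`-th coefficients. Independence over `ℤ`
  -- splits an integer equation for `v` into one for each `q j`.
  let V : Submodule ℤ ℝ := Submodule.span ℤ (range v)
  have : Module.Finite ℤ V := Module.Finite.span_of_finite ℤ (finite_range v)
  let b := Module.finBasis ℤ V
  have hv : ∀ i, v i ∈ V := fun i => Submodule.subset_span ⟨i, rfl⟩
  have key : ∀ i, v i = ∑ j, ((b.repr ⟨v i, hv i⟩ j : ℤ) : ℝ) * (b j : ℝ) := by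
    intro i
    have h := congrArg (Subtype.val) (b.sum_repr ⟨v i, hv i⟩)
    simp only [Submodule.coe_sum, Submodule.coe_smul, zsmul_eq_mul] at h
    exact h.symm
  refine ⟨_, fun j => (b j : ℝ), fun j i => b.repr ⟨v i, hv i⟩ j, ?_, ?_⟩
  · ext i
    rw [key i]
    simp [intVec, mul_comm]
  · intro m hm
    have hli : LinearIndependent ℤ (fun j => (b j : ℝ)) :=
      b.linearIndependent.map' V.subtype (by simp)
    have h0 : ∑ j, (∑ i, m i * b.repr ⟨v i, hv i⟩ j) • (b j : ℝ) = 0 := by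
      rw [latticeForm_apply] at hm
      rw [← hm]
      simp_rw [zsmul_eq_mul]
      push_cast
      simp_rw [Finset.sum_mul]
      rw [Finset.sum_comm]
      refine Finset.sum_congr rfl fun i _ => ?_
      conv_rhs => rw [key i]
      rw [Finset.mul_sum]
      exact Finset.sum_congr rfl fun j _ => by ring
    intro j
    exact Fintype.linearIndependent_iff.1 hli _ h0 j

/-- The inclusion `ℤⁿ → ℚⁿ`. -/
def ratVec (z : Fin n → ℤ) : Fin n → ℚ := fun i => (z i : ℚ)

lemma exists_clear_denominators (x : Fin n → ℚ) :
    ∃ (N : ℕ) (z : Fin n → ℤ), 0 < N ∧ (N : ℚ) • x = ratVec z := by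
  refine ⟨∏ i, (x i).den, fun i => (∏ j ∈ Finset.univ.erase i, ((x j).den : ℤ)) * (x i).num,
    Finset.prod_pos fun i _ => (x i).den_pos, ?_⟩
  ext i
  simp only [Pi.smul_apply, smul_eq_mul, ratVec]
  rw [← Finset.mul_prod_erase Finset.univ _ (Finset.mem_univ i)]
  push_cast
  rw [mul_comm ((x i).den : ℚ), mul_assoc, mul_comm ((x i).den : ℚ), Rat.mul_den_eq_num]

lemma exists_clear_denominators_dual (l : (Fin n → ℚ) →ₗ[ℚ] ℚ) :
    ∃ (N : ℕ) (m : Fin n → ℤ), 0 < N ∧ ∀ z : Fin n → ℤ, ((m ⬝ᵥ z : ℤ) : ℚ) = N * l (ratVec z) := by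
  obtain ⟨N, m, hN, h⟩ := exists_clear_denominators (fun i => l (Pi.single i 1))
  refine ⟨N, m, hN, fun z => ?_⟩
  have hl : l (ratVec z) = ∑ i, (z i : ℚ) * l (Pi.single i 1) := by
    conv_lhs => rw [← Finset.univ_sum_single (ratVec z), map_sum]
    refine Finset.sum_congr rfl fun i _ => ?_
    rw [← smul_eq_mul, ← map_smul, ← Pi.single_smul]
    simp [ratVec]
  rw [hl, Finset.mul_sum]
  simp only [dotProduct]
  push_cast
  refine Finset.sum_congr rfl fun i _ => ?_
  have := congrFun h i
  simp only [Pi.smul_apply, smul_eq_mul, ratVec] at this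
  rw [← this]; ring

lemma intVec_mem_span_of_ratVec_mem_span {G : Set (Fin n → ℤ)} {x : Fin n → ℚ}
    (h : x ∈ Submodule.span ℚ (ratVec '' G)) :
    (fun i => (x i : ℝ)) ∈ Submodule.span ℝ (intVec '' G) := by
  induction h using Submodule.span_induction with
  | mem x hx =>
    obtain ⟨z, hz, rfl⟩ := hx
    refine Submodule.subset_span ⟨z, hz, ?_⟩
    ext i; simp [intVec, ratVec]
  | zero =>
    convert Submodule.zero_mem (Submodule.span ℝ (intVec '' G)) using 1
    ext i; simp
  | add x y _ _ hx hy =>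
    convert Submodule.add_mem _ hx hy using 1
    ext i; simp
  | smul a x _ hx =>
    convert Submodule.smul_mem _ (a : ℝ) hx using 1
    ext i; simp

/-- A real span of integer vectors is cut out by linear equations with integer coefficients. -/
lemma mem_span_intVec_of_annihilated {G : Set (Fin n → ℤ)} {v : Fin n → ℝ}
    (h : ∀ m : Fin n → ℤ, (∀ g ∈ G, m ⬝ᵥ g = 0) → latticeForm m v = 0) :
    v ∈ Submodule.span ℝ (intVec '' G) := by
  obtain ⟨k, r, q, hv, hq⟩ := exists_int_decomposition v
  rw [hv]
  refine Submodule.sum_mem _ fun j _ => Submodule.smul_mem _ _ ?_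
  -- Otherwise a rational form kills `G` but not `q j`. Cleared of denominators, it kills `v` by
  -- `h`, and therefore `q j` by `hq`.
  have : ratVec (q j) ∈ Submodule.span ℚ (ratVec '' G) := by
    by_contra hnot
    obtain ⟨l, hl, hle⟩ := Submodule.exists_le_ker_of_notMem hnot
    obtain ⟨N, m, hN, hm⟩ := exists_clear_denominators_dual l
    have h1 : ∀ g ∈ G, m ⬝ᵥ g = 0 := by
      intro g hg
      have h0 : l (ratVec g) = 0 := hle (Submodule.subset_span ⟨g, hg, rfl⟩)
      have := hm g
      rw [h0, mul_zero] at this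
      exact_mod_cast this
    have h2 := hm (q j)
    rw [hq m (h m h1) j] at h2
    have hN' : (N : ℚ) ≠ 0 := by positivity
    simp [hN', hl] at h2
  have h2 := intVec_mem_span_of_ratVec_mem_span this
  convert h2 using 1
  ext i; simp [intVec, ratVec]

/-- A form vanishing on `A ∩ B` is well defined on the image of `A` in `V ⧸ B`, and over a field it
extends from there to the whole quotient. -/
lemma exists_dual_extension {K V : Type*} [Field K] [AddCommGroup V] [Module K V]
    (A B : Submodule K V) (f : V →ₗ[K] K) (h : ∀ z ∈ A, z ∈ B → f z = 0) :
    ∃ l : V →ₗ[K] K, (∀ b ∈ B, l b = 0) ∧ ∀ a ∈ A, l a = f a := by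
  let g : A →ₗ[K] V ⧸ B := B.mkQ ∘ₗ A.subtype
  have h1 : f ∘ₗ A.subtype ∈ (LinearMap.ker g).dualAnnihilator := by
    rw [Submodule.mem_dualAnnihilator]
    rintro ⟨a, ha⟩ hg
    refine h a ha ?_
    simpa [g] using hg
  rw [← LinearMap.range_dualMap_eq_dualAnnihilator_ker] at h1
  obtain ⟨l, hl⟩ := h1
  refine ⟨l ∘ₗ B.mkQ, fun b hb => ?_, fun a ha => ?_⟩
  · simp [(Submodule.Quotient.mk_eq_zero B).2 hb]
  · exact LinearMap.congr_fun hl ⟨a, ha⟩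

/-- Either the span of `A` and the kernel of the forms in `B` have a common integer vector at which
`f` does not vanish, or a multiple of the restriction of `f` to `A` extends to an integer form
vanishing on the kernel of `B`. -/
lemma exists_intVec_or_exists_form (A B : Set (Fin n → ℤ)) (f : Fin n → ℤ) :
    (∃ z : Fin n → ℤ, intVec z ∈ Submodule.span ℝ (intVec '' A) ∧ (∀ s ∈ B, s ⬝ᵥ z = 0) ∧
      f ⬝ᵥ z ≠ 0) ∨
    ∃ (N : ℕ) (m : Fin n → ℤ), 0 < N ∧ (∀ z : Fin n → ℤ, (∀ s ∈ B, s ⬝ᵥ z = 0) → m ⬝ᵥ z = 0) ∧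
      ∀ a ∈ A, m ⬝ᵥ a = N * (f ⬝ᵥ a) := by
  let φ : (Fin n → ℤ) → (Fin n → ℚ) →ₗ[ℚ] ℚ := fun m => ∑ i, (m i : ℚ) • LinearMap.proj i
  have hφ : ∀ m z, φ m (ratVec z) = ((m ⬝ᵥ z : ℤ) : ℚ) := by
    intro m z; simp [φ, ratVec, dotProduct]
  let B' : Submodule ℚ (Fin n → ℚ) := ⨅ s ∈ B, LinearMap.ker (φ s)
  have hB' : ∀ z, ratVec z ∈ B' ↔ ∀ s ∈ B, s ⬝ᵥ z = 0 := by
    intro z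
    simp only [B', Submodule.mem_iInf, LinearMap.mem_ker, hφ]
    exact forall₂_congr fun s _ => by norm_cast
  by_cases h : ∀ z ∈ Submodule.span ℚ (ratVec '' A), z ∈ B' → φ f z = 0
  · right
    obtain ⟨l, hl, hl'⟩ := exists_dual_extension _ _ _ h
    obtain ⟨N, m, hN, hm⟩ := exists_clear_denominators_dual l
    refine ⟨N, m, hN, fun z hz => ?_, fun a ha => ?_⟩
    · have := hm z
      rw [hl _ ((hB' z).2 hz), mul_zero] at this
      exact_mod_cast this
    · have := hm a
      rw [hl' _ (Submodule.subset_span ⟨a, ha, rfl⟩), hφ] at this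
      exact_mod_cast this
  · left
    push Not at h
    obtain ⟨x, hxA, hxB, hx⟩ := h
    obtain ⟨N, z, hN, hz⟩ := exists_clear_denominators x
    have hNq : (N : ℚ) ≠ 0 := by positivity
    refine ⟨z, ?_, (hB' z).1 (hz ▸ Submodule.smul_mem _ _ hxB), fun h0 => hx ?_⟩
    · have := intVec_mem_span_of_ratVec_mem_span (Submodule.smul_mem _ (N : ℚ) hxA)
      rw [hz] at this
      convert this using 1
      ext i; simp [intVec, ratVec]
    · have h1 := hφ f z
      rw [h0, ← hz, map_smul] at h1
      simpa [hNq] using h1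

/-- Modulo two, a subspace stays larger than a saturated sublattice on which a form vanishes, as
soon as the form does not vanish on the integer points of the subspace. -/
lemma exists_modTwo_notMem_binaryPart {W T : Submodule ℝ (Fin n → ℝ)} (hTW : T ≤ W)
    {f : Fin n → ℤ} (hf : ∀ z : Fin n → ℤ, intVec z ∈ T → f ⬝ᵥ z = 0)
    {z : Fin n → ℤ} (hz : intVec z ∈ W) (hfz : f ⬝ᵥ z ≠ 0) :
    ∃ z : Fin n → ℤ, intVec z ∈ W ∧ modTwo z ∉ binaryPart T := by
  -- Descent: if `z` is congruent modulo two to some `y` in `T`, then `(z - y) / 2` is again an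
  -- integer point of `W`, and `f` takes half the value there because `f` kills `y`. A nonzero
  -- integer cannot be halved forever.
  induction hk : (f ⬝ᵥ z).natAbs using Nat.strong_induction_on generalizing z with
  | _ k ih =>
    by_cases h : modTwo z ∈ binaryPart T
    · obtain ⟨y, hy, hyz⟩ := h
      have hdvd : ∀ i, (2 : ℤ) ∣ z i - y i := by
        intro i
        have := congrFun hyz i
        simp only [modTwo] at this
        rw [ZMod.intCast_eq_intCast_iff_dvd_sub] at this
        exact_mod_cast this
      choose w hw using hdvd
      have hzw : z = y + (2 : ℤ) • w := by
        ext i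
        have := hw i
        simp only [Pi.add_apply, Pi.smul_apply, smul_eq_mul]
        linarith
      have hwW : intVec w ∈ W := by
        have h1 : intVec w = (2⁻¹ : ℝ) • (intVec z - intVec y) := by
          ext i
          rw [hzw]
          simp [intVec]
        rw [h1]
        exact W.smul_mem _ (W.sub_mem hz (hTW hy))
      have hfw : f ⬝ᵥ z = 2 * (f ⬝ᵥ w) := by
        rw [hzw, dotProduct_add, dotProduct_smul, hf y hy]; simp
      refine ih (f ⬝ᵥ w).natAbs ?_ hwW ?_ rfl
      · omega
      · intro h0; rw [h0] at hfw; exact hfz (by simpa using hfw)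
    · exact ⟨z, hz, h⟩

/-! ### Cones -/

lemma IsConeFace.le {κ η : PointedCone ℝ (Fin n → ℝ)} (h : IsConeFace κ η) : κ ≤ η := by
  obtain ⟨m, -, hm⟩ := h
  exact fun x hx => ((hm x).1 hx).1

lemma isConeFace_of_le {κ η : F.cones} (h : κ.1 ≤ η.1) : IsConeFace κ.1 η.1 := by
  have := (F.inter_face κ.1 κ.2 η.1 η.2).2
  rwa [inf_eq_left.2 h] at this

lemma coneSpan_le_ker_iff {κ : PointedCone ℝ (Fin n → ℝ)} {m : Fin n → ℤ} :
    coneSpan κ ≤ LinearMap.ker (latticeForm m) ↔ ∀ x ∈ κ, latticeForm m x = 0 := by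
  rw [coneSpan, Submodule.span_le]
  rfl

lemma latticeForm_nonneg_of_generators {S : Finset (Fin n → ℤ)} {m : Fin n → ℤ}
    (h : ∀ g ∈ S, 0 ≤ m ⬝ᵥ g) {x : Fin n → ℝ}
    (hx : x ∈ PointedCone.hull ℝ (intVec '' (S : Set (Fin n → ℤ)))) : 0 ≤ latticeForm m x := by
  induction hx using Submodule.span_induction with
  | mem x hx =>
    obtain ⟨g, hg, rfl⟩ := hx
    rw [latticeForm_intVec]
    exact_mod_cast h g hg
  | zero => simp
  | add x y _ _ hx hy => rw [map_add]; exact add_nonneg hx hy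
  | smul a x _ hx =>
    have : latticeForm m (a • x) = (a : ℝ) * latticeForm m x := by
      rw [← smul_eq_mul, ← map_smul]; rfl
    rw [this]
    exact mul_nonneg a.2 hx

lemma coneSpan_hull (S : Finset (Fin n → ℤ)) :
    coneSpan (PointedCone.hull ℝ (intVec '' (S : Set (Fin n → ℤ)))) =
      Submodule.span ℝ (intVec '' (S : Set (Fin n → ℤ))) := by
  refine le_antisymm ?_ (Submodule.span_mono Submodule.subset_span)
  rw [coneSpan, Submodule.span_le]
  intro x hx
  induction hx using Submodule.span_induction with
  | mem x hx => exact Submodule.subset_span hx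
  | zero => exact Submodule.zero_mem _
  | add x y _ _ hx hy => exact Submodule.add_mem _ hx hy
  | smul a x _ hx => exact Submodule.smul_mem _ (a : ℝ) hx

/-- A form nonnegative on the face cut out by `μ` becomes nonnegative on the whole cone after adding
a multiple of `μ`. -/
lemma exists_add_nsmul_nonneg {κ : PointedCone ℝ (Fin n → ℝ)} (hκ : IsRationalCone κ)
    {μ m : Fin n → ℤ} (hμ : ∀ x ∈ κ, 0 ≤ latticeForm μ x)
    (hm : ∀ x ∈ κ, latticeForm μ x = 0 → 0 ≤ latticeForm m x) :
    ∃ k : ℕ, ∀ x ∈ κ, 0 ≤ latticeForm (m + k • μ) x := by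
  obtain ⟨S, rfl⟩ := hκ
  -- Generators suffice. Where `μ` vanishes, `hm` applies; elsewhere `μ ⬝ᵥ g ≥ 1` by integrality,
  -- and this `k` dominates every `|m ⬝ᵥ g|`.
  refine ⟨∑ g ∈ S, (m ⬝ᵥ g).natAbs, fun x hx =>
    latticeForm_nonneg_of_generators (fun g hg => ?_) hx⟩
  have hgκ : intVec g ∈ PointedCone.hull ℝ (intVec '' (S : Set (Fin n → ℤ))) :=
    Submodule.subset_span ⟨g, hg, rfl⟩
  have h1 := hμ _ hgκ
  have h2 := hm _ hgκ
  rw [latticeForm_intVec] at h1 h2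
  rw [latticeForm_intVec] at h2
  norm_cast at h1 h2
  rw [add_dotProduct, smul_dotProduct, nsmul_eq_mul]
  have h3 : (m ⬝ᵥ g).natAbs ≤ ∑ g ∈ S, (m ⬝ᵥ g).natAbs :=
    Finset.single_le_sum (f := fun g => (m ⬝ᵥ g).natAbs) (fun _ _ => Nat.zero_le _) hg
  rcases h1.eq_or_lt with h0 | h0
  · rw [← h0, mul_zero, add_zero]; exact h2 h0.symm
  · have h4 : ((∑ g ∈ S, (m ⬝ᵥ g).natAbs : ℕ) : ℤ) ≤
        ((∑ g ∈ S, (m ⬝ᵥ g).natAbs : ℕ) : ℤ) * (μ ⬝ᵥ g) :=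
      le_mul_of_one_le_right (by positivity) h0
    omega

/-! ### Evaluation of forms and the topology -/

lemma evalForm_mkQ {η : F.cones} {m : Fin n → ℤ} (h : ∀ x ∈ η.1, latticeForm m x = 0)
    (x : Fin n → ℝ) :
    evalForm m (⟨η, (coneSpan η.1).mkQ x⟩ : TropToric F) = ((-(latticeForm m x) : ℝ) : EReal) := by
  rw [evalForm, dif_pos (coneSpan_le_ker_iff.2 h)]
  rfl

lemma evalForm_eq_bot_iff {p : TropToric F} {m : Fin n → ℤ} :
    evalForm m p = ⊥ ↔ ¬ ∀ x ∈ p.sed.1, latticeForm m x = 0 := by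
  rw [← coneSpan_le_ker_iff, evalForm]
  split_ifs with h
  · simp [h]
  · simp [h]

lemma exists_eq_mkQ (p : TropToric F) : ∃ x, p = ⟨p.sed, (coneSpan p.sed.1).mkQ x⟩ := by
  obtain ⟨η, y⟩ := p
  obtain ⟨x, rfl⟩ := Submodule.mkQ_surjective _ y
  exact ⟨x, rfl⟩

lemma continuous_evalForm {η : F.cones} {m : Fin n → ℤ} (hm : ∀ x ∈ η.1, 0 ≤ latticeForm m x) :
    Continuous (fun p : Chart η => evalForm m p.1) :=
  continuous_iInf_dom (i := (⟨m, hm⟩ : {m : Fin n → ℤ // ∀ x ∈ η.1, 0 ≤ latticeForm m x}))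
    continuous_induced_dom

lemma isOpen_iff_chart {U : Set (TropToric F)} :
    IsOpen U ↔ ∀ η : F.cones, IsOpen ((fun p : Chart η => p.1) ⁻¹' U) := by
  rw [isOpen_iSup_iff]
  exact forall_congr' fun η => isOpen_coinduced

lemma isClosed_iff_chart {U : Set (TropToric F)} :
    IsClosed U ↔ ∀ η : F.cones, IsClosed ((fun p : Chart η => p.1) ⁻¹' U) := by
  simp only [← isOpen_compl_iff, isOpen_iff_chart, preimage_compl]

/-- The closure of an orbit consists of orbits of larger cones. -/
lemma isClosed_setOf_le_sed (ρ : F.cones) : IsClosed {p : TropToric F | ρ.1 ≤ p.sed.1} := by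
  rw [isClosed_iff_chart]
  intro η
  by_cases hρη : ρ.1 ≤ η.1
  · have : ((fun p : Chart η => p.1) ⁻¹' {p : TropToric F | ρ.1 ≤ p.sed.1}) =
        ⋂ m : {m : Fin n → ℤ // (∀ x ∈ η.1, 0 ≤ latticeForm m x) ∧
          ¬ ∀ x ∈ ρ.1, latticeForm m x = 0}, (fun p : Chart η => evalForm m.1 p.1) ⁻¹' {⊥} := by
      ext p
      simp only [mem_preimage, mem_ofPred_eq, mem_iInter, mem_singleton_iff, evalForm_eq_bot_iff]
      constructor
      · rintro h ⟨m, hm, hm'⟩ h0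
        exact hm' fun x hx => h0 x (h hx)
      · intro h
        -- The form cutting `p.sed` out of `η` has a finite value at `p`. If `ρ` were not contained
        -- in `p.sed`, it would be nonzero on `ρ`, and its value would have to be `⊥`.
        obtain ⟨m, hm, hm'⟩ := p.2
        by_contra hle
        refine h ⟨m, hm, fun h0 => hle fun x hx => (hm' x).2 ⟨hρη hx, h0 x hx⟩⟩
          fun x hx => ((hm' x).1 hx).2
    rw [this]
    exact isClosed_iInter fun m => isClosed_singleton.preimage (continuous_evalForm m.2.1)
  · convert isClosed_empty
    ext p
    simp only [mem_preimage, mem_ofPred_eq, mem_empty_iff_false, iff_false]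
    exact fun h => hρη (h.trans p.2.le)

/-- In the chart of another cone `κ` the form `m` may take negative values, so its evaluation need
not be continuous there. With `μ` cutting `κ ⊓ η` out of `κ`, the forms `μ` and `m + k • μ` are both
nonnegative on `κ`. The condition that `μ` evaluates above a real `t` keeps the point in the orbits
of faces of `η`, where the value of `m` is the difference of the continuous values of `m + k • μ`
and of `k • μ`. -/
lemma isOpen_setOf_evalForm_lt {η : F.cones} {m : Fin n → ℤ}
    (hm : ∀ x ∈ η.1, 0 ≤ latticeForm m x) (c : ℝ) :
    IsOpen {p : TropToric F | p.sed.1 ≤ η.1 ∧ evalForm m p < c} := by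
  rw [isOpen_iff_chart]
  intro κ
  obtain ⟨μ, hμ, hμ'⟩ := (F.inter_face κ.1 κ.2 η.1 η.2).1
  obtain ⟨k, hk⟩ := exists_add_nsmul_nonneg (F.rational κ.1 κ.2) hμ (m := m)
    (fun x hx h0 => hm x ((hμ' x).2 ⟨hx, h0⟩).2)
  have : ((fun p : Chart κ => p.1) ⁻¹' {p : TropToric F | p.sed.1 ≤ η.1 ∧ evalForm m p < c}) =
      ⋃ t : ℝ, ((fun p : Chart κ => evalForm μ p.1) ⁻¹' (Ioi (t : EReal))) ∩
        ((fun p : Chart κ => evalForm (m + k • μ) p.1) ⁻¹' (Iio ((c + k * t : ℝ) : EReal))) := by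
    ext q
    simp only [mem_preimage, mem_ofPred_eq, mem_iUnion, mem_inter_iff, mem_Ioi, mem_Iio]
    have hp := q.2
    generalize q.1 = p at hp ⊢
    obtain ⟨x, hx⟩ := exists_eq_mkQ p
    have hsed : p.sed.1 ≤ η.1 ↔ ∀ x ∈ p.sed.1, latticeForm μ x = 0 := by
      constructor
      · intro h x hx
        exact ((hμ' x).1 ⟨hp.le hx, h hx⟩).2
      · intro h x hx
        exact ((hμ' x).2 ⟨hp.le hx, h x hx⟩).2
    by_cases h : ∀ x ∈ p.sed.1, latticeForm μ x = 0
    · have e1 : evalForm μ p = ((-(latticeForm μ x) : ℝ) : EReal) := by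
        rw [hx]; exact evalForm_mkQ h x
      rw [e1]
      by_cases h' : ∀ x ∈ p.sed.1, latticeForm m x = 0
      · have e2 : evalForm m p = ((-(latticeForm m x) : ℝ) : EReal) := by
          rw [hx]; exact evalForm_mkQ h' x
        have e3 : evalForm (m + k • μ) p =
            ((-(latticeForm m x + k * latticeForm μ x) : ℝ) : EReal) := by
          rw [hx, evalForm_mkQ _ x]
          · simp [latticeForm_add_nsmul, -nsmul_eq_mul]
          · intro y hy; simp [latticeForm_add_nsmul, -nsmul_eq_mul, h y hy, h' y hy]
        rw [e2, e3]
        simp only [EReal.coe_lt_coe_iff, hsed]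
        constructor
        · rintro ⟨-, hlt⟩
          have hk1 : (0 : ℝ) < k + 1 := by positivity
          set δ := c + latticeForm m x with hδ
          have hδ0 : 0 < δ := by linarith
          -- The slack is `δ`; lowering `t` by `δ / (k + 1)` costs only `k * δ / (k + 1) < δ`.
          refine ⟨-latticeForm μ x - δ / (k + 1), by have := div_pos hδ0 hk1; linarith, ?_⟩
          have : (k : ℝ) * (δ / (k + 1)) < δ := by
            rw [mul_div_assoc', div_lt_iff₀ hk1]; nlinarith
          rw [mul_sub]; linarith
        · rintro ⟨t, ht, hlt⟩
          refine ⟨h, ?_⟩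
          have : (k : ℝ) * t ≤ k * (-latticeForm μ x) := by gcongr
          linarith
      · have e2 : evalForm m p = ⊥ := evalForm_eq_bot_iff.2 h'
        have e3 : evalForm (m + k • μ) p = ⊥ := by
          rw [evalForm_eq_bot_iff]
          intro h0
          refine h' fun y hy => ?_
          have := h0 y hy
          simpa [latticeForm_add_nsmul, -nsmul_eq_mul, h y hy] using this
        rw [e2, e3]
        simp only [EReal.coe_lt_coe_iff, hsed]
        refine ⟨fun _ => ⟨-latticeForm μ x - 1, by linarith, EReal.bot_lt_coe _⟩,
          fun _ => ⟨h, EReal.bot_lt_coe _⟩⟩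
    · have e1 : evalForm μ p = ⊥ := evalForm_eq_bot_iff.2 h
      rw [e1, hsed]
      simp [h]
  rw [this]
  exact isOpen_iUnion fun t => (isOpen_Ioi.preimage (continuous_evalForm hμ)).inter
    (isOpen_Iio.preimage (continuous_evalForm hk))

/-- A lower bound for the values of a form persists in the closure. -/
lemma le_evalForm_of_mem_closure {A : Set (TropToric F)} {p : TropToric F} (hp : p ∈ closure A)
    {m : Fin n → ℤ} (hm : ∀ x ∈ p.sed.1, 0 ≤ latticeForm m x) {c : ℝ}
    (hA : ∀ a ∈ A, (c : EReal) ≤ evalForm m a) : (c : EReal) ≤ evalForm m p := by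
  by_contra! hlt
  obtain ⟨a, ha, haA⟩ := mem_closure_iff.1 hp _ (isOpen_setOf_evalForm_lt hm c) ⟨le_rfl, hlt⟩
  exact absurd ha.2 (not_lt.2 (hA a haA))

/-! ### Polyhedra -/

lemma coneSpan_le_comap_mkQ (ρ : F.cones) (V : Submodule ℝ (OrbitSpace ρ)) :
    coneSpan ρ.1 ≤ V.comap (coneSpan ρ.1).mkQ := by
  intro x hx
  rw [Submodule.mem_comap, Submodule.mkQ_apply, (Submodule.Quotient.mk_eq_zero _).2 hx]
  exact V.zero_mem

/-- A polyhedron has a point at which all inequalities are strict, except for those that are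
equalities on the whole polyhedron. -/
lemma exists_forall_eq_imp_forall_eq {V ι : Type*} [AddCommGroup V] [Module ℝ V] {P : Set V}
    (hP : Convex ℝ P) (hne : P.Nonempty) (S : Finset ι) (l : ι → V →ₗ[ℝ] ℝ) (c : ι → ℝ)
    (hle : ∀ x ∈ P, ∀ s ∈ S, l s x ≤ c s) :
    ∃ x ∈ P, ∀ s ∈ S, l s x = c s → ∀ y ∈ P, l s y = c s := by
  classical
  induction S using Finset.induction_on with
  | empty => obtain ⟨x, hx⟩ := hne; exact ⟨x, hx, by simp⟩
  | insert s S _ ih =>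
    obtain ⟨x, hx, hxS⟩ := ih fun x hx t ht => hle x hx t (Finset.mem_insert_of_mem ht)
    by_cases h : ∀ y ∈ P, l s y = c s
    · refine ⟨x, hx, fun t ht => ?_⟩
      rcases Finset.mem_insert.1 ht with rfl | ht
      · exact fun _ => h
      · exact hxS t ht
    · push Not at h
      obtain ⟨y, hy, hys⟩ := h
      -- At the midpoint an inequality is an equality only if it is one at both `x` and `y`.
      refine ⟨(1 / 2 : ℝ) • x + (1 / 2 : ℝ) • y,
        hP hx hy (by norm_num) (by norm_num) (by norm_num), fun t ht h0 => ?_⟩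
      have h1 := hle x hx t ht
      have h2 := hle y hy t ht
      simp only [map_add, map_smul, smul_eq_mul] at h0
      rcases Finset.mem_insert.1 ht with rfl | ht
      · exact absurd (by linarith) hys
      · exact hxS t ht (by linarith)

/-- The preimage in `ℝⁿ` of the tangent space of a polyhedron. -/
def TropPoly.tangent (σ : TropPoly F) : Submodule ℝ (Fin n → ℝ) :=
  (vectorSpan ℝ σ.part).comap (coneSpan σ.sed.1).mkQ

lemma TropPoly.sub_mem_tangent (σ : TropPoly F) {x y : Fin n → ℝ}
    (hx : (coneSpan σ.sed.1).mkQ x ∈ σ.part) (hy : (coneSpan σ.sed.1).mkQ y ∈ σ.part) :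
    x - y ∈ σ.tangent := by
  rw [tangent, Submodule.mem_comap, map_sub]
  exact vsub_mem_vectorSpan ℝ hx hy

lemma TropPoly.coneSpan_le_tangent (σ : TropPoly F) : coneSpan σ.sed.1 ≤ σ.tangent :=
  coneSpan_le_comap_mkQ _ _

/-- A polyhedron has a relative interior point, and its tangent space is cut out by linear equations
with integer coefficients. -/
lemma TropPoly.exists_relint (σ : TropPoly F) :
    ∃ (B : Set (Fin n → ℤ)) (x₀ : Fin n → ℝ), (coneSpan σ.sed.1).mkQ x₀ ∈ σ.part ∧
      (∀ v, v ∈ σ.tangent ↔ ∀ s ∈ B, latticeForm s v = 0) ∧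
      ∀ v ∈ σ.tangent, ∃ ε : ℝ, 0 < ε ∧ (coneSpan σ.sed.1).mkQ (x₀ + ε • v) ∈ σ.part := by
  obtain ⟨S, hS, hP⟩ := σ.rational
  let Q : Set (Fin n → ℝ) := {x | ∀ s ∈ S, latticeForm s.1 x ≤ s.2}
  have hQ : Convex ℝ Q := by
    intro x hx y hy a b ha hb hab s hs
    have h1 := mul_le_mul_of_nonneg_left (hx s hs) ha
    have h2 := mul_le_mul_of_nonneg_left (hy s hs) hb
    simp only [map_add, map_smul, smul_eq_mul]
    calc _ ≤ a * s.2 + b * s.2 := add_le_add h1 h2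
      _ = s.2 := by rw [← add_mul, hab, one_mul]
  have hne : Q.Nonempty := by
    obtain ⟨y, hy⟩ := σ.nonempty
    obtain ⟨x, rfl⟩ := Submodule.mkQ_surjective _ y
    exact ⟨x, (hP x).1 hy⟩
  obtain ⟨x₀, hx₀, hrel⟩ := exists_forall_eq_imp_forall_eq hQ hne S (fun s => latticeForm s.1)
    (fun s => s.2) (fun x hx s hs => hx s hs)
  -- The inequalities active at `x₀` are those that are equalities on all of the polyhedron; the
  -- others leave room to move in every direction.
  let B : Set (Fin n → ℤ) := {m | ∃ s ∈ S, s.1 = m ∧ latticeForm s.1 x₀ = s.2}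
  have hmove : ∀ v, (∀ s ∈ B, latticeForm s v = 0) →
      ∃ ε : ℝ, 0 < ε ∧ (coneSpan σ.sed.1).mkQ (x₀ + ε • v) ∈ σ.part := by
    intro v hv
    have hev : ∀ᶠ ε : ℝ in 𝓝[>] 0, ∀ s ∈ S, latticeForm s.1 (x₀ + ε • v) ≤ s.2 := by
      rw [Filter.eventually_all_finset]
      intro s hs
      by_cases h : latticeForm s.1 x₀ = s.2
      · refine Filter.Eventually.of_forall fun ε => ?_
        rw [map_add, map_smul, hv s.1 ⟨s, hs, rfl, h⟩, smul_zero, add_zero, h]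
      · have hlt : latticeForm s.1 x₀ < s.2 := lt_of_le_of_ne (hx₀ s hs) h
        have hc : Continuous fun ε : ℝ => latticeForm s.1 x₀ + ε * latticeForm s.1 v := by fun_prop
        have h0 : ∀ᶠ ε : ℝ in 𝓝 0, latticeForm s.1 x₀ + ε * latticeForm s.1 v < s.2 :=
          hc.continuousAt.eventually_lt continuousAt_const (by simpa using hlt)
        filter_upwards [nhdsWithin_le_nhds h0] with ε hε
        rw [map_add, map_smul, smul_eq_mul]
        exact hε.le
    obtain ⟨ε, hε, hε0⟩ := (hev.and self_mem_nhdsWithin).exists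
    exact ⟨ε, hε0, (hP _).2 hε⟩
  have htan : ∀ v, v ∈ σ.tangent ↔ ∀ s ∈ B, latticeForm s v = 0 := by
    intro v
    constructor
    · intro hv s hs
      have hker : coneSpan σ.sed.1 ≤ LinearMap.ker (latticeForm s) := by
        obtain ⟨t, ht, rfl, -⟩ := hs
        exact coneSpan_le_ker_iff.2 (hS t ht)
      have hle : vectorSpan ℝ σ.part ≤ LinearMap.ker ((coneSpan σ.sed.1).liftQ _ hker) := by
        rw [vectorSpan_def, Submodule.span_le]
        rintro _ ⟨a, ha, b, hb, rfl⟩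
        obtain ⟨x, rfl⟩ := Submodule.mkQ_surjective _ a
        obtain ⟨y, rfl⟩ := Submodule.mkQ_surjective _ b
        obtain ⟨t, ht, rfl, h0⟩ := hs
        simp only [vsub_eq_sub, SetLike.mem_coe, LinearMap.mem_ker, map_sub, Submodule.mkQ_apply,
          Submodule.liftQ_apply]
        rw [hrel t ht h0 x ((hP x).1 ha), hrel t ht h0 y ((hP y).1 hb), sub_self]
      exact hle hv
    · intro hv
      obtain ⟨ε, hε, hmem⟩ := hmove v hv
      have := σ.sub_mem_tangent hmem ((hP x₀).2 hx₀)
      rw [add_sub_cancel_left] at this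
      exact (Submodule.smul_mem_iff _ hε.ne').1 this
  exact ⟨B, x₀, (hP x₀).2 hx₀, htan, fun v hv => hmove v ((htan v).1 hv)⟩

/-- A real solution of integer linear equations is a real combination of integer solutions. -/
lemma latticeForm_eq_zero_of_intVec {B : Set (Fin n → ℤ)} {m : Fin n → ℤ}
    (hm : ∀ z : Fin n → ℤ, (∀ s ∈ B, s ⬝ᵥ z = 0) → m ⬝ᵥ z = 0) {v : Fin n → ℝ}
    (hv : ∀ s ∈ B, latticeForm s v = 0) : latticeForm m v = 0 := by
  obtain ⟨k, r, q, rfl, hq⟩ := exists_int_decomposition v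
  rw [map_sum]
  refine Finset.sum_eq_zero fun j _ => ?_
  rw [map_smul, latticeForm_intVec, hm (q j) fun s hs => hq s (hv s hs) j]
  simp

/-! ### Closures of polyhedra and their traces on boundary orbits. -/

namespace TropPoly

lemma mk_mem_carrier (σ : TropPoly F) {y : OrbitSpace σ.sed} (hy : y ∈ σ.part) :
    (⟨σ.sed, y⟩ : TropToric F) ∈ σ.carrier :=
  subset_closure ⟨y, hy, rfl⟩

lemma carrier_nonempty (σ : TropPoly F) : σ.carrier.Nonempty := by
  obtain ⟨y, hy⟩ := σ.nonempty
  exact ⟨_, σ.mk_mem_carrier hy⟩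

lemma isClosed_carrier (σ : TropPoly F) : IsClosed σ.carrier := isClosed_closure

lemma sed_le_of_mem_carrier {σ : TropPoly F} {p : TropToric F} (hp : p ∈ σ.carrier) :
    σ.sed.1 ≤ p.sed.1 := by
  refine closure_minimal ?_ (isClosed_setOf_le_sed σ.sed) hp
  rintro _ ⟨y, -, rfl⟩
  exact le_refl σ.sed.1

/-- The closure adds no points in the orbit of the sedentarity itself: each defining inequality
bounds from below the evaluation of a form vanishing on that cone, and such bounds persist in the
closure. -/
lemma slice_carrier_sed (σ : TropPoly F) : slice σ.carrier σ.sed = σ.part := by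
  refine Subset.antisymm (fun y hy => ?_) fun y hy => σ.mk_mem_carrier hy
  obtain ⟨x, rfl⟩ := Submodule.mkQ_surjective _ y
  obtain ⟨S, hS, hP⟩ := σ.rational
  refine (hP x).2 fun s hs => ?_
  have h := le_evalForm_of_mem_closure (p := ⟨σ.sed, (coneSpan σ.sed.1).mkQ x⟩) hy (m := s.1)
    (fun y hy => (hS s hs y hy).ge) (c := -s.2) (by
      rintro _ ⟨y, hy, rfl⟩
      obtain ⟨x, rfl⟩ := Submodule.mkQ_surjective _ y
      rw [evalForm_mkQ (hS s hs), EReal.coe_le_coe_iff]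
      exact neg_le_neg ((hP x).1 hy s hs))
  rw [evalForm_mkQ (hS s hs), EReal.coe_le_coe_iff] at h
  exact neg_le_neg_iff.1 h

lemma sed_le_of_carrier_subset {σ τ : TropPoly F} (h : τ.carrier ⊆ σ.carrier) :
    σ.sed.1 ≤ τ.sed.1 := by
  obtain ⟨y, hy⟩ := τ.nonempty
  exact sed_le_of_mem_carrier (h (τ.mk_mem_carrier hy))

lemma carrier_injective {σ τ : TropPoly F} (h : σ.carrier = τ.carrier) : σ = τ := by
  have hsed : σ.sed = τ.sed := Subtype.ext
    (le_antisymm (sed_le_of_carrier_subset h.ge) (sed_le_of_carrier_subset h.le))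
  have h1 := σ.slice_carrier_sed
  have h2 := τ.slice_carrier_sed
  obtain ⟨ρ, P, _, _⟩ := σ
  obtain ⟨ρ', P', _, _⟩ := τ
  dsimp only at hsed h1 h2
  subst hsed
  rw [h] at h1
  obtain rfl : P = P' := h1.symm.trans h2
  rfl

lemma IsFace.carrier_subset {σ τ : TropPoly F} (h : τ.IsFace σ) : τ.carrier ⊆ σ.carrier := by
  refine closure_minimal ?_ σ.isClosed_carrier
  rintro _ ⟨y, hy, rfl⟩
  obtain ⟨-, l, hl⟩ := h
  rw [hl] at hy
  exact hy.1

/-- The value of a form which vanishes on the tangent space of a polyhedron is a lower bound for its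
values on the closure. -/
lemma le_evalForm_of_forall_tangent {σ : TropPoly F} {m : Fin n → ℤ} {x₀ : Fin n → ℝ}
    (hx₀ : (coneSpan σ.sed.1).mkQ x₀ ∈ σ.part)
    (hm : ∀ v ∈ σ.tangent, latticeForm m v = 0) {p : TropToric F} (hp : p ∈ σ.carrier)
    (hpm : ∀ x ∈ p.sed.1, 0 ≤ latticeForm m x) :
    ((-latticeForm m x₀ : ℝ) : EReal) ≤ evalForm m p := by
  refine le_evalForm_of_mem_closure hp hpm ?_
  rintro _ ⟨y, hy, rfl⟩
  obtain ⟨x, rfl⟩ := Submodule.mkQ_surjective _ y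
  rw [evalForm_mkQ (fun x hx => hm x (σ.coneSpan_le_tangent (Submodule.subset_span hx)))]
  have := hm _ (σ.sub_mem_tangent hy hx₀)
  rw [map_sub, sub_eq_zero] at this
  rw [this]

/-- If a polyhedron reaches the orbit of a larger cone, then its tangent space and the span of the
cone have, even modulo two, a common direction outside of the span of the sedentarity. -/
lemma exists_direction {σ : TropPoly F} {p : TropToric F} (hp : p ∈ σ.carrier)
    (hne : p.sed ≠ σ.sed) :
    ∃ z : Fin n → ℤ, intVec z ∈ σ.tangent ∧ intVec z ∈ coneSpan p.sed.1 ∧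
      modTwo z ∉ binaryPart (coneSpan σ.sed.1) := by
  have hle := sed_le_of_mem_carrier hp
  obtain ⟨f, hf, hfσ⟩ := isConeFace_of_le hle
  obtain ⟨A, hA⟩ := F.rational _ p.sed.2
  obtain ⟨B, x₀, hx₀, hB, -⟩ := σ.exists_relint
  have hBint : ∀ z, intVec z ∈ σ.tangent ↔ ∀ s ∈ B, s ⬝ᵥ z = 0 := by
    intro z
    rw [hB]
    simp only [latticeForm_intVec, Int.cast_eq_zero]
  have hspan : coneSpan p.sed.1 = Submodule.span ℝ (intVec '' (A : Set (Fin n → ℤ))) := by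
    rw [hA, coneSpan_hull]
  -- Either `f` is nonzero at an integer vector of `T(σ) ∩ T(p.sed)`, and descent inside this
  -- intersection finishes, or a form `m` vanishes on `T(σ)` and equals `N * f` on the span of
  -- `p.sed`.
  rcases exists_intVec_or_exists_form (A : Set (Fin n → ℤ)) B f with
    ⟨z, hzA, hzB, hfz⟩ | ⟨N, m, hN, hmB, hmA⟩
  · have hker := coneSpan_le_ker_iff.2 fun x hx => ((hfσ x).1 hx).2
    obtain ⟨z, hz, hz'⟩ := exists_modTwo_notMem_binaryPart (W := σ.tangent ⊓ coneSpan p.sed.1)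
      (T := coneSpan σ.sed.1) (le_inf σ.coneSpan_le_tangent (Submodule.span_mono hle)) (f := f)
      (fun z hz => by
        have := hker hz
        rw [LinearMap.mem_ker, latticeForm_intVec] at this
        exact_mod_cast this)
      (z := z) ⟨(hBint z).2 hzB, hspan ▸ hzA⟩ hfz
    exact ⟨z, hz.1, hz.2, hz'⟩
  · exfalso
    have hm : ∀ x ∈ coneSpan p.sed.1, latticeForm m x = N * latticeForm f x := by
      intro x hx
      rw [hspan] at hx
      induction hx using Submodule.span_induction with
      | mem x hx =>
        obtain ⟨a, ha, rfl⟩ := hx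
        rw [latticeForm_intVec, latticeForm_intVec, hmA a ha]
        push_cast; rfl
      | zero => simp
      | add x y _ _ hx hy => rw [map_add, map_add, hx, hy, mul_add]
      | smul a x _ hx => rw [map_smul, map_smul, hx, smul_eq_mul, smul_eq_mul]; ring
    have hm' : ∀ x ∈ p.sed.1, latticeForm m x = N * latticeForm f x :=
      fun x hx => hm x (Submodule.subset_span hx)
    have h := le_evalForm_of_forall_tangent (m := m) hx₀
      (fun v hv => latticeForm_eq_zero_of_intVec hmB ((hB v).1 hv)) hp
      (fun x hx => by rw [hm' x hx]; exact mul_nonneg (Nat.cast_nonneg _) (hf x hx))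
    -- Since `m` is constant on `σ.part`, its value at the limit point `p` is bounded below, hence
    -- finite. So `m`, and with it `f`, vanishes on `p.sed`, which puts `p.sed` inside the face
    -- `σ.sed`.
    have hbot : evalForm m p ≠ ⊥ := by
      intro h0
      rw [h0] at h
      exact absurd h (not_le.2 (EReal.bot_lt_coe _))
    rw [Ne, evalForm_eq_bot_iff, not_not] at hbot
    refine hne (Subtype.ext (le_antisymm (fun x hx => (hfσ x).2 ⟨hx, ?_⟩) hle))
    have h1 := hbot x hx
    rw [hm' x hx] at h1
    have hN' : (N : ℝ) ≠ 0 := by positivity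
    simpa [hN'] using h1

/-- An integer form `m` vanishing on both `T(σ)` and `T(η)` is constant on `σ.part`, and the closure
bounds for `m` and `-m` carry this constant over to the orbit of `η`. Such forms cut out the sum of
the two spaces, as both are spanned by integer vectors. -/
lemma sub_mem_tangent_sup {σ : TropPoly F} {η : F.cones} {x y : Fin n → ℝ}
    (hx : (coneSpan η.1).mkQ x ∈ slice σ.carrier η)
    (hy : (coneSpan η.1).mkQ y ∈ slice σ.carrier η) : x - y ∈ σ.tangent ⊔ coneSpan η.1 := by
  obtain ⟨B, x₀, hx₀, hB, -⟩ := σ.exists_relint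
  obtain ⟨A, hA⟩ := F.rational _ η.2
  have hG := mem_span_intVec_of_annihilated
    (G := {z | intVec z ∈ σ.tangent} ∪ {z | intVec z ∈ coneSpan η.1}) (v := x - y) (by
      intro m hm
      have hmη : ∀ x ∈ η.1, latticeForm m x = 0 := by
        have : coneSpan η.1 ≤ LinearMap.ker (latticeForm m) := by
          rw [hA, coneSpan_hull, Submodule.span_le]
          rintro _ ⟨a, ha, rfl⟩
          rw [SetLike.mem_coe, LinearMap.mem_ker, latticeForm_intVec, hm a, Int.cast_zero]
          refine Or.inr ?_
          rw [mem_ofPred_eq, hA, coneSpan_hull]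
          exact Submodule.subset_span ⟨a, ha, rfl⟩
        exact coneSpan_le_ker_iff.1 this
      have hmσ : ∀ v ∈ σ.tangent, latticeForm m v = 0 := by
        refine fun v hv => latticeForm_eq_zero_of_intVec (fun z hz => hm z (Or.inl ?_))
          ((hB v).1 hv)
        rw [mem_ofPred_eq, hB]
        intro s hs
        rw [latticeForm_intVec, hz s hs, Int.cast_zero]
      have hconst : ∀ x, (coneSpan η.1).mkQ x ∈ slice σ.carrier η →
          latticeForm m x = latticeForm m x₀ := by
        intro x hx
        have h1 := le_evalForm_of_forall_tangent (m := m) hx₀ hmσ hx (fun x hx => (hmη x hx).ge)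
        have h2 := le_evalForm_of_forall_tangent (m := -m) hx₀
          (fun v hv => by rw [latticeForm_neg, LinearMap.neg_apply, hmσ v hv, neg_zero]) hx
          (fun x hx => by rw [latticeForm_neg, LinearMap.neg_apply, hmη x hx, neg_zero])
        rw [evalForm_mkQ hmη, EReal.coe_le_coe_iff] at h1
        rw [evalForm_mkQ (fun x hx => by
          rw [latticeForm_neg, LinearMap.neg_apply, hmη x hx, neg_zero]),
          EReal.coe_le_coe_iff, latticeForm_neg, LinearMap.neg_apply, LinearMap.neg_apply] at h2
        linarith
      rw [map_sub, hconst x hx, hconst y hy, sub_self])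
  refine Submodule.span_le.2 ?_ hG
  rintro _ ⟨z, hz | hz, rfl⟩
  · exact Submodule.mem_sup_left hz
  · exact Submodule.mem_sup_right hz

lemma finrank_map_lt {K V V' : Type*} [DivisionRing K] [AddCommGroup V] [Module K V]
    [AddCommGroup V'] [Module K V'] (U : Submodule K V) [FiniteDimensional K U] (f : V →ₗ[K] V')
    {u : V} (hu : u ∈ U) (hu0 : u ≠ 0) (hfu : f u = 0) :
    Module.finrank K (U.map f) < Module.finrank K U := by
  have h := LinearMap.finrank_range_add_finrank_ker (f.domRestrict U)
  rw [LinearMap.range_domRestrict] at h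
  have hpos : 0 < Module.finrank K (LinearMap.ker (f.domRestrict U)) := by
    rw [Module.finrank_pos_iff_exists_ne_zero]
    exact ⟨⟨⟨u, hu⟩, hfu⟩, fun h0 => hu0 (congrArg (fun w => w.1.1) h0)⟩
  omega

/-- The part of a polyhedron in the orbit of a cone larger than the sedentarity has smaller
dimension. -/
lemma finrank_vectorSpan_slice_lt {σ : TropPoly F} {η : F.cones}
    (h : (slice σ.carrier η).Nonempty) (hne : η ≠ σ.sed) :
    Module.finrank ℝ (vectorSpan ℝ (slice σ.carrier η)) < σ.dim := by
  obtain ⟨y, hy⟩ := h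
  have hle : σ.sed.1 ≤ η.1 := sed_le_of_mem_carrier (p := ⟨η, y⟩) hy
  have hle' : coneSpan σ.sed.1 ≤ coneSpan η.1 := Submodule.span_mono hle
  obtain ⟨z, hzσ, hzη, hz⟩ := exists_direction (p := ⟨η, y⟩) hy hne
  let q : OrbitSpace σ.sed →ₗ[ℝ] OrbitSpace η :=
    (coneSpan σ.sed.1).mapQ (coneSpan η.1) LinearMap.id hle'
  have hq : ∀ x, q ((coneSpan σ.sed.1).mkQ x) = (coneSpan η.1).mkQ x := fun x => rfl
  -- The trace on the orbit of `η` has its directions in the image of `T(σ)`, and the projection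
  -- kills the nonzero class of `z`.
  have h1 : vectorSpan ℝ (slice σ.carrier η) ≤ (vectorSpan ℝ σ.part).map q := by
    rw [vectorSpan_def, Submodule.span_le]
    rintro _ ⟨a, ha, b, hb, rfl⟩
    obtain ⟨x, rfl⟩ := Submodule.mkQ_surjective _ a
    obtain ⟨y, rfl⟩ := Submodule.mkQ_surjective _ b
    obtain ⟨w, hw, t, ht, hwt⟩ := Submodule.mem_sup.1 (sub_mem_tangent_sup ha hb)
    refine ⟨(coneSpan σ.sed.1).mkQ w, hw, ?_⟩
    have ht0 : (coneSpan η.1).mkQ t = 0 := (Submodule.Quotient.mk_eq_zero _).2 ht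
    change _ = (coneSpan η.1).mkQ x - (coneSpan η.1).mkQ y
    rw [hq, ← map_sub, ← hwt, map_add, ht0, add_zero]
  refine (Submodule.finrank_mono h1).trans_lt
    (finrank_map_lt _ q (u := (coneSpan σ.sed.1).mkQ (intVec z)) hzσ ?_ ?_)
  · intro h0
    exact hz ⟨z, (Submodule.Quotient.mk_eq_zero _).1 h0, rfl⟩
  · rw [hq]
    exact (Submodule.Quotient.mk_eq_zero _).2 hzη

end TropPoly

/-- The functional maximized on `A` vanishes on the directions of `A`. When these are all directions
of `Q`, it is constant on `Q`, and every point is maximal. -/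
lemma IsPolyhedronFace.eq_of_finrank_eq {V : Type*} [AddCommGroup V] [Module ℝ V]
    [FiniteDimensional ℝ V] {A Q : Set V} (h : IsPolyhedronFace A Q)
    (hd : Module.finrank ℝ (vectorSpan ℝ Q) ≤ Module.finrank ℝ (vectorSpan ℝ A)) : A = Q := by
  obtain ⟨⟨a, ha⟩, l, hl⟩ := h
  have hsub : A ⊆ Q := by rw [hl]; exact fun x hx => hx.1
  have heq : vectorSpan ℝ A = vectorSpan ℝ Q :=
    Submodule.eq_of_le_of_finrank_le (vectorSpan_mono ℝ hsub) hd
  have hker : vectorSpan ℝ A ≤ LinearMap.ker l := by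
    rw [vectorSpan_def, Submodule.span_le]
    rintro _ ⟨x, hx, y, hy, rfl⟩
    rw [hl] at hx hy
    change l (x - y) = 0
    rw [map_sub, sub_eq_zero]
    exact le_antisymm (hy.2 x hx.1) (hx.2 y hy.1)
  refine hsub.antisymm fun x hx => ?_
  have h1 : l (x -ᵥ a) = 0 := hker (heq ▸ vsub_mem_vectorSpan ℝ hx (hsub ha))
  rw [vsub_eq_sub, map_sub, sub_eq_zero] at h1
  rw [hl] at ha ⊢
  exact ⟨hx, h1 ▸ ha.2⟩

/-- There is a point of a polyhedron which is contained in no proper face. -/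
lemma TropPoly.exists_forall_face_eq (σ : TropPoly F) :
    ∃ y ∈ σ.part, ∀ A, IsPolyhedronFace A σ.part → y ∈ A → A = σ.part := by
  obtain ⟨-, x₀, hx₀, -, hmove⟩ := σ.exists_relint
  refine ⟨_, hx₀, ?_⟩
  rintro A ⟨-, l, rfl⟩ ⟨-, hmax⟩
  refine Subset.antisymm (fun x hx => hx.1) fun y hy => ⟨hy, fun w hw => (hmax w hw).trans ?_⟩
  obtain ⟨x, rfl⟩ := Submodule.mkQ_surjective _ y
  -- From the relative interior point one can move a little further away from `x`. A functional
  -- maximal at `x₀` cannot increase that way, so it is at least as large at `x`.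
  obtain ⟨ε, hε, hmem⟩ := hmove _ (σ.sub_mem_tangent hx₀ hy)
  have h := hmax _ hmem
  rw [map_add, map_add, map_smul, map_smul, map_sub, map_sub, smul_eq_mul] at h
  nlinarith

/-! ### Facets of a polyhedral complex -/

namespace TropPoly

lemma carrier_subset_of_slice_subset {σ τ : TropPoly F} (h : σ.sed = τ.sed)
    (hsl : slice σ.carrier τ.sed ⊆ τ.part) : σ.carrier ⊆ τ.carrier := by
  refine closure_minimal ?_ τ.isClosed_carrier
  rintro _ ⟨y, hy, rfl⟩
  obtain ⟨y', hy'⟩ : ∃ y', (⟨σ.sed, y⟩ : TropToric F) = ⟨τ.sed, y'⟩ := by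
    rw [← h]; exact ⟨y, rfl⟩
  have hmem := σ.mk_mem_carrier hy
  dsimp only
  rw [hy'] at hmem ⊢
  exact τ.mk_mem_carrier (hsl hmem)

lemma finrank_vectorSpan_slice_le {σ : TropPoly F} {η : F.cones}
    (h : (slice σ.carrier η).Nonempty) :
    Module.finrank ℝ (vectorSpan ℝ (slice σ.carrier η)) ≤ σ.dim := by
  by_cases hη : η = σ.sed
  · subst hη
    rw [slice_carrier_sed]
    exact le_rfl
  · exact (finrank_vectorSpan_slice_lt h hη).le

/-- A face of full dimension is the whole polyhedron. -/
lemma IsFace.eq_of_dim_eq {σ τ : TropPoly F} (h : τ.IsFace σ) (hd : τ.dim = σ.dim) : τ = σ := by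
  obtain ⟨y, hy⟩ := τ.nonempty
  have hne : (slice σ.carrier τ.sed).Nonempty := ⟨y, h.carrier_subset (τ.mk_mem_carrier hy)⟩
  have hpart : τ.part = slice σ.carrier τ.sed :=
    IsPolyhedronFace.eq_of_finrank_eq h ((finrank_vectorSpan_slice_le hne).trans hd.ge)
  have hsed : τ.sed = σ.sed := by
    by_contra hsed
    have := finrank_vectorSpan_slice_lt hne hsed
    rw [← hpart] at this
    exact this.ne hd
  exact carrier_injective (h.carrier_subset.antisymm
    (carrier_subset_of_slice_subset hsed.symm hpart.ge))

end TropPoly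

namespace PolyComplex

variable {X : PolyComplex F} {ρ : F.cones} {d : ℕ}

/-- The two members meet in a common face, here with the same carrier as `τ`, and the carrier
determines the polyhedron. -/
lemma isFace_of_carrier_subset {σ τ : TropPoly F} (hσ : σ ∈ X.faces) (hτ : τ ∈ X.faces)
    (h : τ.carrier ⊆ σ.carrier) : τ.IsFace σ := by
  obtain ⟨κ, hκ, -, hκc⟩ := X.inter_face σ hσ τ hτ
    (by rw [inter_eq_right.2 h]; exact τ.carrier_nonempty)
  rw [inter_eq_right.2 h] at hκc
  rwa [← TropPoly.carrier_injective hκc]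

lemma eq_of_mem_facets {σ τ : TropPoly F} (hσ : σ ∈ X.facets) (hτ : τ ∈ X.faces)
    (h : σ.carrier ⊆ τ.carrier) : τ = σ :=
  TropPoly.carrier_injective ((hσ.2 τ hτ h).antisymm h)

lemma finite_facets_of_carrier_subset (τ : TropPoly F) :
    {σ : X.facets | τ.carrier ⊆ σ.1.carrier}.Finite := by
  obtain ⟨p, hp⟩ := τ.carrier_nonempty
  have h := X.locallyFinite.point_finite p
  refine Set.Finite.of_finite_image (f := fun σ => (⟨σ.1, σ.2.1⟩ : X.faces))
    (h.subset ?_) fun σ _ σ' _ h => Subtype.ext (congrArg (fun w => w.1) h)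
  rintro _ ⟨σ, hσ, rfl⟩
  exact hσ hp

lemma mem_support {p : TropToric F} : p ∈ X.support ↔ ∃ σ ∈ X.faces, p ∈ σ.carrier := by
  simp [support]

lemma IsPureSed.le_sed (h : X.IsPureSed ρ) {σ : TropPoly F} (hσ : σ ∈ X.faces) :
    ρ.1 ≤ σ.sed.1 := by
  obtain ⟨y, hy⟩ := σ.nonempty
  have hmem : (⟨σ.sed, y⟩ : TropToric F) ∈ X.support := mem_support.2 ⟨σ, hσ, σ.mk_mem_carrier hy⟩
  rw [h] at hmem
  refine closure_minimal ?_ (isClosed_setOf_le_sed ρ) hmem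
  rintro p ⟨-, hp⟩
  exact (congrArg Subtype.val hp).ge

/-- The facets of a complex of pure sedentarity `ρ` have sedentarity `ρ`. -/
lemma IsPureSed.sed_eq (h : X.IsPureSed ρ) {σ : TropPoly F} (hσ : σ ∈ X.facets) : σ.sed = ρ := by
  obtain ⟨y, hy, hrel⟩ := σ.exists_forall_face_eq
  have hp := σ.mk_mem_carrier hy
  have hcl : (⟨σ.sed, y⟩ : TropToric F) ∈ closure (X.support ∩ orbit ρ) := by
    rw [← h]; exact mem_support.2 ⟨σ, hσ.1, hp⟩
  have hun : X.support ∩ orbit ρ = ⋃ σ : X.faces, σ.1.carrier ∩ orbit ρ := by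
    ext p
    simp only [mem_inter_iff, mem_support, mem_iUnion]
    exact ⟨fun ⟨⟨σ, h, h'⟩, h''⟩ => ⟨⟨σ, h⟩, h', h''⟩, fun ⟨⟨σ, h⟩, h', h''⟩ => ⟨⟨σ, h, h'⟩, h''⟩⟩
  -- By local finiteness the relative interior point `y` of `σ` lies in the closure of the `ρ`-part
  -- of a single member `σ'`. The common face of `σ` and `σ'` contains `y`, so it is all of `σ`, and
  -- maximality gives `σ' = σ`.
  rw [hun, (X.locallyFinite.subset fun σ => inter_subset_left).closure_iUnion, mem_iUnion] at hcl
  obtain ⟨⟨σ', hσ'⟩, hcl⟩ := hcl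
  obtain ⟨q, hq, hqρ⟩ := closure_nonempty_iff.1 ⟨_, hcl⟩
  have hsed' : σ'.sed.1 ≤ ρ.1 :=
    (TropPoly.sed_le_of_mem_carrier hq).trans (congrArg Subtype.val hqρ).le
  have hp' : (⟨σ.sed, y⟩ : TropToric F) ∈ σ'.carrier :=
    closure_minimal inter_subset_left σ'.isClosed_carrier hcl
  obtain ⟨κ, hκ, -, hκc⟩ := X.inter_face σ hσ.1 σ' hσ' ⟨_, hp, hp'⟩
  have hpκ : (⟨σ.sed, y⟩ : TropToric F) ∈ κ.carrier := hκc ▸ ⟨hp, hp'⟩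
  have hsed : κ.sed = σ.sed := Subtype.ext (le_antisymm (TropPoly.sed_le_of_mem_carrier hpκ)
    (TropPoly.sed_le_of_carrier_subset hκ.carrier_subset))
  have hσκ : σ.carrier ⊆ κ.carrier := by
    refine TropPoly.carrier_subset_of_slice_subset hsed.symm ?_
    have hκ' : IsPolyhedronFace κ.part (slice σ.carrier κ.sed) := hκ
    rw [← κ.slice_carrier_sed, hsed, σ.slice_carrier_sed] at hκ'
    rw [← κ.slice_carrier_sed, hsed, σ.slice_carrier_sed]
    exact (hrel _ hκ' hpκ).ge
  have hσσ' : σ' = σ := eq_of_mem_facets hσ hσ' (hσκ.trans (hκc.le.trans inter_subset_right))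
  subst hσσ'
  exact Subtype.ext (le_antisymm hsed' (h.le_sed hσ'))

end PolyComplex

/-! ### Polyhedra in the real tropical toric variety -/

lemma realMk_eq_iff {v w : Fin n → ZMod 2} {p q : TropToric F} :
    realMk v p = realMk w q ↔ p = q ∧ v - w ∈ binaryPart (coneSpan p.sed.1) :=
  Quotient.eq (r := signSetoid F)

lemma signMk_eq_iff {ρ : F.cones} {v w : Fin n → ZMod 2} :
    signMk ρ v = signMk ρ w ↔ v - w ∈ binaryPart (coneSpan ρ.1) :=
  Submodule.Quotient.eq _

lemma signMk_surjective (ρ : F.cones) : Function.Surjective (signMk ρ) :=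
  Submodule.mkQ_surjective _

lemma signProj_signMk {ρ η : F.cones} (h : ρ.1 ≤ η.1) (v : Fin n → ZMod 2) :
    signProj h (signMk ρ v) = signMk η v := rfl

lemma signProj_signProj {ρ η κ : F.cones} (h : ρ.1 ≤ η.1) (h' : η.1 ≤ κ.1) (δ : SignSpace ρ) :
    signProj h' (signProj h δ) = signProj (h.trans h') δ := by
  obtain ⟨v, rfl⟩ := signMk_surjective ρ δ
  rfl

lemma signProj_self {ρ : F.cones} (h : ρ.1 ≤ ρ.1) (δ : SignSpace ρ) : signProj h δ = δ := by
  obtain ⟨v, rfl⟩ := signMk_surjective ρ δ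
  rfl

lemma signProj_bijective_of_eq {ρ η : F.cones} (h : ρ.1 ≤ η.1) (he : ρ = η) :
    Function.Bijective (signProj h) := by
  subst he
  have : ⇑(signProj h) = id := funext fun δ => signProj_self h δ
  rw [this]
  exact Function.bijective_id

namespace RealCell

lemma realMk_mem_carrier_iff {a : RealCell F} {v : Fin n → ZMod 2} {p : TropToric F} :
    realMk v p ∈ a.carrier ↔ p ∈ a.poly.carrier ∧
      ∃ h : a.poly.sed.1 ≤ p.sed.1, signProj h a.sign = signMk p.sed v := by
  constructor
  · rintro ⟨w, hw, q, hq, heq⟩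
    obtain ⟨rfl, hmem⟩ := realMk_eq_iff.1 heq
    refine ⟨hq, TropPoly.sed_le_of_mem_carrier hq, ?_⟩
    rw [← hw, signProj_signMk, signMk_eq_iff]
    exact hmem
  · rintro ⟨hp, h, hs⟩
    obtain ⟨w, hw⟩ := signMk_surjective _ a.sign
    refine ⟨w, hw, p, hp, realMk_eq_iff.2 ⟨rfl, ?_⟩⟩
    rwa [← hw, signProj_signMk, signMk_eq_iff] at hs

/-- Signs need comparing only at one point of sedentarity `b.poly.sed`: at other points of the cell,
further projection merely forgets information. -/
lemma carrier_subset_iff {a b : RealCell F} :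
    b.carrier ⊆ a.carrier ↔ b.poly.carrier ⊆ a.poly.carrier ∧
      ∃ h : a.poly.sed.1 ≤ b.poly.sed.1, signProj h a.sign = b.sign := by
  obtain ⟨v, hv⟩ := signMk_surjective _ b.sign
  constructor
  · intro hsub
    have hmem : ∀ p ∈ b.poly.carrier, realMk v p ∈ a.carrier := fun p hp => hsub ⟨v, hv, p, hp, rfl⟩
    refine ⟨fun p hp => (realMk_mem_carrier_iff.1 (hmem p hp)).1, ?_⟩
    obtain ⟨y, hy⟩ := b.poly.nonempty
    rw [← hv]
    exact (realMk_mem_carrier_iff.1 (hmem _ (b.poly.mk_mem_carrier hy))).2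
  · rintro ⟨hsub, h, hs⟩ _ ⟨w, hw, p, hp, rfl⟩
    refine realMk_mem_carrier_iff.2 ⟨hsub hp, h.trans (TropPoly.sed_le_of_mem_carrier hp), ?_⟩
    rw [← signProj_signProj h (TropPoly.sed_le_of_mem_carrier hp), hs, ← hw, signProj_signMk]

end RealCell

/-- Forgetting the sign. -/
def RealTropToric.forget : RealTropToric F → TropToric F :=
  Quotient.lift (fun a => a.2) fun _ _ h => h.1

lemma RealTropToric.continuous_forget : Continuous (forget : RealTropToric F → TropToric F) := by
  have : Continuous (fun a : Σ _ : Fin n → ZMod 2, TropToric F => a.2) :=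
    continuous_sigma fun _ => continuous_id
  exact this.quotient_lift _

lemma RealCell.forget_mem_carrier {a : RealCell F} {q : RealTropToric F} (hq : q ∈ a.carrier) :
    q.forget ∈ a.poly.carrier := by
  obtain ⟨v, -, p, hp, rfl⟩ := hq
  exact hp

instance (ρ : F.cones) : Finite (SignSpace ρ) :=
  Finite.of_surjective _ (signMk_surjective ρ)

/-! ### The patchwork -/

section Patchwork

variable {X : PolyComplex F} {ρ : F.cones} {d : ℕ} (E : RealPhaseStructure X ρ d)

lemma mem_patchwork_of_isFace {a b : RealCell F} (ha : a ∈ patchwork E) (h : b.IsFace a) :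
    b ∈ patchwork E := by
  obtain ⟨hX, σ, hσ, hle, δ, hδ, hs⟩ := ha
  obtain ⟨hsub, hle', hs'⟩ := RealCell.carrier_subset_iff.1 h.2
  refine ⟨X.face_mem _ hX _ h.1, σ, hsub.trans hσ, hle.trans hle', δ, hδ, ?_⟩
  rw [← signProj_signProj hle hle', hs, hs']

/-- Local finiteness pulls back along the continuous map forgetting signs, because each polyhedron
has only finitely many copies. -/
lemma locallyFinite_patchwork : LocallyFinite (fun a : patchwork E => a.1.carrier) := by
  intro q
  obtain ⟨U, hU, hfin⟩ := X.locallyFinite q.forget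
  refine ⟨_, RealTropToric.continuous_forget.continuousAt hU, ?_⟩
  let g : {a : patchwork E | (a.1.carrier ∩ RealTropToric.forget ⁻¹' U).Nonempty} →
      Σ σ : {σ : X.faces | (σ.1.carrier ∩ U).Nonempty}, SignSpace σ.1.1.sed :=
    fun a => ⟨⟨⟨a.1.1.poly, a.1.2.1⟩, by
      obtain ⟨x, hx, hxU⟩ := a.2
      exact ⟨_, RealCell.forget_mem_carrier hx, hxU⟩⟩, a.1.1.sign⟩
  have := hfin.to_subtype
  refine Finite.of_injective g fun a b hab => Subtype.ext (Subtype.ext ?_)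
  have h : (fun w : Σ σ : {σ : X.faces | (σ.1.carrier ∩ U).Nonempty}, SignSpace σ.1.1.sed =>
      (⟨w.1.1.1, w.2⟩ : RealCell F)) (g a) = (fun w => ⟨w.1.1.1, w.2⟩) (g b) := by rw [hab]
  exact h

/-- The polyhedron `σ(δ)` for a facet `σ` and `δ ∈ ℤ₂(ρ)`. -/
def facetCell (hsed : X.IsPureSed ρ) (w : X.facets × SignSpace ρ) : RealCell F :=
  ⟨w.1.1, signProj (hsed.le_sed w.1.2.1) w.2⟩

/-- Facets have sedentarity `ρ`, so the projection in `facetCell` is only a transport along an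
equality of cones. -/
lemma facetCell_injective (hsed : X.IsPureSed ρ) : Function.Injective (facetCell hsed) := by
  rintro ⟨σ, δ⟩ ⟨σ', δ'⟩ h
  obtain rfl : σ = σ' := Subtype.ext (congrArg RealCell.poly h)
  refine Prod.ext rfl ((signProj_bijective_of_eq (hsed.le_sed σ.2.1) (hsed.sed_eq σ.2).symm).1 ?_)
  simpa [facetCell] using h

lemma carrier_subset_facetCell_iff (hsed : X.IsPureSed ρ) {b : RealCell F}
    (hb : ρ.1 ≤ b.poly.sed.1)
    {w : X.facets × SignSpace ρ} :
    b.carrier ⊆ (facetCell hsed w).carrier ↔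
      b.poly.carrier ⊆ w.1.1.carrier ∧ signProj hb w.2 = b.sign := by
  rw [RealCell.carrier_subset_iff]
  refine and_congr_right fun h => ?_
  exact ⟨fun ⟨_, h'⟩ => (signProj_signProj _ _ _).symm.trans h',
    fun h' => ⟨TropPoly.sed_le_of_carrier_subset h, (signProj_signProj _ _ _).trans h'⟩⟩

lemma facetCell_mem_patchwork (hsed : X.IsPureSed ρ) {w : X.facets × SignSpace ρ}
    (hw : w.2 ∈ E.phase w.1) :
    facetCell hsed w ∈ patchwork E :=
  ⟨w.1.2.1, w.1, Subset.rfl, hsed.le_sed w.1.2.1, w.2, hw, rfl⟩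

lemma exists_facetCell_of_mem_patchwork (hsed : X.IsPureSed ρ) {a : RealCell F}
    (ha : a ∈ patchwork E) :
    ∃ w : X.facets × SignSpace ρ, w.2 ∈ E.phase w.1 ∧ a.carrier ⊆ (facetCell hsed w).carrier := by
  obtain ⟨-, σ, hσ, h, δ, hδ, hs⟩ := ha
  exact ⟨(σ, δ), hδ, (carrier_subset_facetCell_iff hsed h).2 ⟨hσ, hs⟩⟩

/-- A member of the patchwork over a facet is of the form `σ(δ)` with `δ ∈ ℰ(σ)`. -/
lemma exists_eq_facetCell (hsed : X.IsPureSed ρ) {a : RealCell F} (ha : a ∈ patchwork E)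
    (hfac : a.poly ∈ X.facets) :
    ∃ w : X.facets × SignSpace ρ, w.2 ∈ E.phase w.1 ∧ facetCell hsed w = a := by
  obtain ⟨a, s⟩ := a
  obtain ⟨hX, σ, hσ, h, δ, hδ, hs⟩ := ha
  obtain ⟨σ, hσX⟩ := σ
  dsimp only at *
  obtain rfl := PolyComplex.eq_of_mem_facets hfac hσX.1 hσ
  exact ⟨(⟨_, hσX⟩, δ), hδ, congrArg (RealCell.mk _) hs⟩

/-- Every member lies in some `σ(δ)` over a facet, so a maximal one has the same underlying
polyhedron. Conversely, a member containing `σ(δ)` lies over `σ` by maximality of `σ`, and then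
carries the same sign. -/
lemma mem_realFacets_iff (hsed : X.IsPureSed ρ) {a : RealCell F} :
    a ∈ realFacets (patchwork E) ↔
      ∃ w : X.facets × SignSpace ρ, w.2 ∈ E.phase w.1 ∧ facetCell hsed w = a := by
  constructor
  · rintro ⟨ha, hmax⟩
    obtain ⟨w, hw, hsub⟩ := exists_facetCell_of_mem_patchwork E hsed ha
    have hsub' := hmax _ (facetCell_mem_patchwork E hsed hw) hsub
    have heq := TropPoly.carrier_injective ((RealCell.carrier_subset_iff.1 hsub).1.antisymm
      (RealCell.carrier_subset_iff.1 hsub').1)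
    refine exists_eq_facetCell E hsed ha ?_
    rw [heq]
    exact w.1.2
  · rintro ⟨w, hw, rfl⟩
    refine ⟨facetCell_mem_patchwork E hsed hw, fun a ha hsub => ?_⟩
    obtain ⟨hsub', h, hs⟩ := RealCell.carrier_subset_iff.1 hsub
    have heq : a.poly = (facetCell hsed w).poly := PolyComplex.eq_of_mem_facets w.1.2 ha.1 hsub'
    obtain ⟨a, s⟩ := a
    dsimp only at heq
    subst heq
    rw [signProj_self] at hs
    dsimp only at hs
    rw [hs]

/-- The reduction modulo two of the vector from `exists_direction`; it serves as a translation
preserving the fibres of `π` in `ℰ(σ)`. -/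
lemma TropPoly.exists_mem_binaryTangent {σ : TropPoly F} (hσ : σ.sed = ρ) {p : TropToric F}
    (hp : p ∈ σ.carrier) (hne : p.sed ≠ ρ) (h : ρ.1 ≤ p.sed.1) :
    ∃ u ∈ binaryTangent ρ (slice σ.carrier ρ), u ≠ 0 ∧ signProj h u = 0 := by
  subst hσ
  obtain ⟨z, hz, hz', hz''⟩ := exists_direction hp hne
  refine ⟨signMk σ.sed (modTwo z), ?_, ?_, ?_⟩
  · rw [slice_carrier_sed]
    exact ⟨_, ⟨z, hz, rfl⟩, rfl⟩
  · intro h0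
    rw [← map_zero (signMk σ.sed), signMk_eq_iff, sub_zero] at h0
    exact hz'' h0
  · rw [signProj_signMk, ← map_zero (signMk p.sed), signMk_eq_iff, sub_zero]
    exact ⟨z, hz', rfl⟩

/-! ### Parity of the facet counts. -/

lemma even_ncard_of_involution {α : Type*} {s : Set α} (hs : s.Finite) (g : α → α)
    (hg : ∀ a ∈ s, g a ∈ s) (hne : ∀ a ∈ s, g a ≠ a) (hgg : ∀ a ∈ s, g (g a) = a) :
    Even s.ncard := by
  rw [ncard_eq_toFinset_card s hs, ← ZMod.natCast_eq_zero_iff_even, Finset.cast_card]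
  refine Finset.sum_involution (fun a _ => g a) (fun _ _ => by decide) (fun a ha _ => ?_)
    (fun a ha => ?_) fun a ha => ?_
  · exact hne a (by simpa using ha)
  · simpa using hg a (by simpa using ha)
  · exact hgg a (by simpa using ha)

lemma finite_facet_signs (τ : TropPoly F) (ε : SignSpace τ.sed) (hτ : ρ.1 ≤ τ.sed.1) :
    {w : X.facets × SignSpace ρ | w.2 ∈ E.phase w.1 ∧ τ.carrier ⊆ w.1.1.carrier ∧
      signProj hτ w.2 = ε}.Finite :=
  ((X.finite_facets_of_carrier_subset τ).prod finite_univ).subset fun _ hw => ⟨hw.2.1, mem_univ _⟩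

lemma even_ncard_facet_signs (hsed : X.IsPureSed ρ) {τ : TropPoly F} (hτX : τ ∈ X.faces)
    (hd : τ.dim + 1 = d) (ε : SignSpace τ.sed) (hτ : ρ.1 ≤ τ.sed.1) :
    Even {w : X.facets × SignSpace ρ | w.2 ∈ E.phase w.1 ∧ τ.carrier ⊆ w.1.1.carrier ∧
      signProj hτ w.2 = ε}.ncard := by
  -- Only this first case uses the even covering condition and the dimension of `τ`; in a boundary
  -- orbit each facet has an even count separately.
  by_cases hρ : τ.sed = ρ
  · obtain ⟨hinj, hsurj⟩ := signProj_bijective_of_eq hτ hρ.symm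
    obtain ⟨δ, rfl⟩ := hsurj ε
    have heven := (E.evenCovering τ hτX hρ hd).2 δ
    let g : {σ : X.facets // τ.carrier ⊆ σ.1.carrier} → X.facets × SignSpace ρ := fun σ => (σ.1, δ)
    have hg : Function.Injective g := fun σ σ' h => Subtype.ext (congrArg Prod.fst h)
    convert heven using 1
    rw [← Set.coe_ofPred, Nat.card_coe_set_eq, ← ncard_image_of_injective _ hg]
    congr 1
    ext ⟨σ, δ'⟩
    constructor
    · rintro ⟨h1, h2, h3⟩
      obtain rfl := hinj h3
      exact ⟨⟨σ, h2⟩, h1, rfl⟩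
    · rintro ⟨⟨σ', h2⟩, h1, h⟩
      obtain ⟨rfl, rfl⟩ := Prod.mk.inj h
      exact ⟨h1, h2, rfl⟩
  · obtain ⟨y, hy⟩ := τ.nonempty
    have hu : ∀ σ : X.facets, ∃ u : SignSpace ρ, τ.carrier ⊆ σ.1.carrier →
        u ∈ (E.phase σ).direction ∧ u ≠ 0 ∧ signProj hτ u = 0 := by
      intro σ
      by_cases h : τ.carrier ⊆ σ.1.carrier
      · obtain ⟨u, hu⟩ := TropPoly.exists_mem_binaryTangent (hsed.sed_eq σ.2)
          (h (τ.mk_mem_carrier hy)) hρ hτ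
        rw [← E.parallel] at hu
        exact ⟨u, fun _ => hu⟩
      -- A dummy value: nothing is required at facets not containing `τ`.
      · exact ⟨0, fun h' => absurd h' h⟩
    choose u hu using hu
    -- Translation by `u σ` stays in `ℰ(σ)` because `u σ` is a direction of it, and in the fibre
    -- because `π` kills `u σ`. It moves every sign since `u σ ≠ 0`, and squares to the identity in
    -- characteristic two.
    refine even_ncard_of_involution (finite_facet_signs E τ ε hτ) (fun w => (w.1, u w.1 + w.2))
      ?_ ?_ ?_
    · rintro ⟨σ, δ⟩ ⟨h1, h2, h3⟩
      obtain ⟨hu1, -, hu3⟩ := hu σ h2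
      exact ⟨AffineSubspace.vadd_mem_of_mem_direction hu1 h1, h2, by
        rw [map_add, hu3, zero_add]; exact h3⟩
    · rintro ⟨σ, δ⟩ ⟨-, h2, -⟩ h
      exact (hu σ h2).2.1 (add_eq_right.1 (congrArg Prod.snd h))
    · rintro ⟨σ, δ⟩ -
      refine Prod.ext rfl ?_
      change u σ + (u σ + δ) = δ
      rw [← add_assoc, ZModModule.add_self, zero_add]

lemma setOf_realFacets_eq (hsed : X.IsPureSed ρ) {b : RealCell F} (hb : ρ.1 ≤ b.poly.sed.1) :
    {a | a ∈ realFacets (patchwork E) ∧ b.carrier ⊆ a.carrier} = facetCell hsed ''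
      {w | w.2 ∈ E.phase w.1 ∧ b.poly.carrier ⊆ w.1.1.carrier ∧ signProj hb w.2 = b.sign} := by
  ext a
  constructor
  · rintro ⟨ha, hsub⟩
    obtain ⟨w, hw, rfl⟩ := (mem_realFacets_iff E hsed).1 ha
    exact ⟨w, ⟨hw, (carrier_subset_facetCell_iff hsed hb).1 hsub⟩, rfl⟩
  · rintro ⟨w, ⟨hw, h⟩, rfl⟩
    exact ⟨(mem_realFacets_iff E hsed).2 ⟨w, hw, rfl⟩, (carrier_subset_facetCell_iff hsed hb).2 h⟩

lemma finite_and_even_ncard_realFacets (hsed : X.IsPureSed ρ) {b : RealCell F}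
    (hb : b ∈ patchwork E)
    (hd : b.dim + 1 = d) :
    {a | a ∈ realFacets (patchwork E) ∧ b.carrier ⊆ a.carrier}.Finite ∧
      Even {a | a ∈ realFacets (patchwork E) ∧ b.carrier ⊆ a.carrier}.ncard := by
  have hle := hsed.le_sed hb.1
  rw [setOf_realFacets_eq E hsed hle, ncard_image_of_injective _ (facetCell_injective hsed)]
  exact ⟨(finite_facet_signs E b.poly b.sign hle).image _,
    even_ncard_facet_signs E hsed hb.1 hd b.sign hle⟩

/-- The `d`-dimensional members of the patchwork with a given face are the facets containing it. -/
lemma mem_and_dim_eq_and_isFace_iff (hsed : X.IsPureSed ρ) (hdim : X.IsPureDim d) {a b : RealCell F}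
    (hb : b ∈ patchwork E) :
    (a ∈ patchwork E ∧ a.dim = d) ∧ b.IsFace a ↔
      a ∈ realFacets (patchwork E) ∧ b.carrier ⊆ a.carrier := by
  constructor
  · rintro ⟨⟨ha, had⟩, hface⟩
    refine ⟨(mem_realFacets_iff E hsed).2 (exists_eq_facetCell E hsed ha ?_), hface.2⟩
    obtain ⟨σ, hσ, -⟩ := ha.2
    -- A `d`-dimensional member is a face of a `d`-dimensional facet, hence equal to it.
    rw [(PolyComplex.isFace_of_carrier_subset σ.2.1 ha.1 hσ).eq_of_dim_eq
      (had.trans (hdim _ σ.2).symm)]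
    exact σ.2
  · rintro ⟨ha, hsub⟩
    refine ⟨⟨ha.1, ?_⟩, PolyComplex.isFace_of_carrier_subset ha.1.1 hb.1
      (RealCell.carrier_subset_iff.1 hsub).1, hsub⟩
    obtain ⟨w, -, rfl⟩ := (mem_realFacets_iff E hsed).1 ha
    exact hdim _ w.1.2

lemma boundary_fundamentalChain (hsed : X.IsPureSed ρ) (hdim : X.IsPureDim d) :
    (fundamentalChain (patchwork E) (d : ℤ)).boundary = fun _ => 0 := by
  funext ⟨b, hb, hbd⟩
  -- Degrees are integers, so for `d = 0` the boundary sits in degree `-1`, where there are no cells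
  -- and nothing to check.
  have hbd' : b.dim + 1 = d := by omega
  obtain ⟨hfin, heven⟩ := finite_and_even_ncard_realFacets E hsed hb hbd'
  let s : Set {a : RealCell F // a ∈ patchwork E ∧ (a.dim : ℤ) = d} := {a | b.IsFace a.1}
  have hs : Subtype.val '' s =
      {a | a ∈ realFacets (patchwork E) ∧ b.carrier ⊆ a.carrier} := by
    ext a
    change _ ↔ a ∈ realFacets (patchwork E) ∧ b.carrier ⊆ a.carrier
    rw [← mem_and_dim_eq_and_isFace_iff E hsed hdim hb]
    constructor
    · rintro ⟨⟨a, ha, had⟩, h, rfl⟩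
      exact ⟨⟨ha, by exact_mod_cast had⟩, h⟩
    · rintro ⟨⟨ha, had⟩, h⟩
      exact ⟨⟨a, ha, by exact_mod_cast had⟩, h, rfl⟩
  have hsfin : s.Finite := (hs ▸ hfin).of_finite_image Subtype.val_injective.injOn
  rw [← hs, ncard_image_of_injective _ Subtype.val_injective] at heven
  change ∑ᶠ (a) (_ : a ∈ s), (1 : ZMod 2) = 0
  rw [finsum_mem_eq_finite_toFinset_sum _ hsfin, ← Finset.cast_card,
    ← ncard_eq_toFinset_card s hsfin]
  exact ZMod.natCast_eq_zero_iff_even.2 heven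

end Patchwork

end TropPatch

end

theorem proposition2p7 {n : ℕ} (F : TropPatch.RatFan n) (ρ : F.cones) (d : ℕ)
    (X : TropPatch.PolyComplex F) (hdim : X.IsPureDim d) (hsed : X.IsPureSed ρ)
    (E : TropPatch.RealPhaseStructure X ρ d) :
    -- the patchwork carries cellular Borel-Moore chains: it is closed under faces and locally finite
    (∀ a ∈ TropPatch.patchwork E, ∀ b : TropPatch.RealCell F, b.IsFace a →
      b ∈ TropPatch.patchwork E) ∧
    LocallyFinite (fun a : TropPatch.patchwork E => a.1.carrier) ∧
    -- the chain of its `d`-dimensional polyhedra is closed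
    (TropPatch.fundamentalChain (TropPatch.patchwork E) (d : ℤ)).boundary = (fun _ => 0) ∧
    -- every codimension one face lies in an even number of facets
    (∀ b ∈ TropPatch.patchwork E, b.dim + 1 = d →
      {a | a ∈ TropPatch.realFacets (TropPatch.patchwork E) ∧ b.carrier ⊆ a.carrier}.Finite ∧
      Even {a | a ∈ TropPatch.realFacets (TropPatch.patchwork E) ∧
        b.carrier ⊆ a.carrier}.ncard) :=
  ⟨fun _ ha _ h => TropPatch.mem_patchwork_of_isFace E ha h, TropPatch.locallyFinite_patchwork E,
    TropPatch.boundary_fundamentalChain E hsed hdim,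
    fun _ hb hd => TropPatch.finite_and_even_ncard_realFacets E hsed hb hd⟩
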